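/- Let $k$ be a field, $n\ge 2$ an integer, and $q\in k$ a primitive $n$-th root of unity. Let $U_n(q)=k\langle a,b\mid a^n=0,\ b^n=1,\ ba=qab\rangle$ be the half quantum group (Taft algebra), with coproduct $\Delta(b)=b\otimes b$, $\Delta(a)=a\otimes b+1\otimes a$ and counit $\varepsilon(b)=1$, $\varepsilon(a)=0$. It is a Hopf subalgebra of its quantum double, which as an algebra is $$D=D(U_n(q))=k\langle a,b,c,d\mid a^n=0=d^n,\ b^n=1=c^n,\ ba=qab,\ dc=qcd,\ db=qbd,\ bc=cb,\ ca=qac,\ da-qad=1-bc\rangle .$$ Put $R=U_n(q)$ and $R^+=\ker(\varepsilon\colon R\to k)$, and let $Q=D/R^+D$, viewed as a right $U_n(q)$-module by restriction; the tensor product $Q\otimes Q=Q\otimes_k Q$ is a right $U_n(q)$-module through $\Delta$. For $i\in\mathbb Z$ put $e_i=\frac1n\sum_{j=0}^{n-1}q^{(i-1)j}b^j$, and for $1\le x\le n$ and $y\in\mathbb Z$ let $M(x,y)$ be the right ideal $e_{x-y+1}\,a^{n-x}\,U_n(q)$ of $U_n(q)$. Then the $n^2$ right $U_n(q)$-modules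 $M(x,y)$, $1\le x\le n$, $0\le y\le n-1$, are indecomposable and pairwise non-isomorphic, and every indecomposable right $U_n(q)$-module is isomorphic to one of them. Every indecomposable right $U_n(q)$-module is isomorphic to a direct summand of $Q\otimes Q$. Moreover, $Q\otimes Q$ is an internal direct sum of finitely many indecomposable submodules, and in every such (Krull–Schmidt) decomposition each indecomposable right $U_n(q)$-module is isomorphic to one of the summands. -/

import Mathlib

open TensorProduct MulOpposite

universe u w

/-! ### Indecomposable modules, direct summands, Krull–Schmidt decompositions

A right module over a ring `A` is a `Module Aᵐᵒᵖ M`. -/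

section Modules

variable (A : Type*) [Ring A]

/-- A nonzero module that is not the direct sum of two nonzero submodules. -/
def IsIndecomposableModule (M : Type*) [AddCommGroup M] [Module A M] : Prop :=
  Nontrivial M ∧ ∀ S T : Submodule A M, IsCompl S T → S = ⊥ ∨ T = ⊥

/-- `M` is isomorphic to a direct summand of `W`. -/
def IsSummandOf (M W : Type*) [AddCommGroup M] [Module A M] [AddCommGroup W] [Module A W] :
    Prop :=
  ∃ S T : Submodule A W, IsCompl S T ∧ Nonempty (M ≃ₗ[A] S)

/-- `W` is the internal direct sum of the finitely many indecomposable submodules `V i`. -/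
structure IsKrullSchmidtDecomposition {W : Type*} [AddCommGroup W] [Module A W] {m : ℕ}
    (V : Fin m → Submodule A W) : Prop where
  independent : iSupIndep V
  span : ⨆ i, V i = ⊤
  indecomposable : ∀ i, IsIndecomposableModule A (V i)

end Modules

/-! ### Tensor products of right modules over a bialgebra -/

section RightTensor

/-- The tensor product over `k` of two right `H`-modules, on which `H` acts as below. -/
def RightTensor (k _H M N : Type*) [Field k] [AddCommGroup M] [Module k M] [AddCommGroup N]
    [Module k N] : Type _ := M ⊗[k] N

variable (k H : Type*) [Field k] [Ring H] [Bialgebra k H]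
variable (M N : Type*) [AddCommGroup M] [Module k M] [Module Hᵐᵒᵖ M] [IsScalarTower k Hᵐᵒᵖ M]
variable [AddCommGroup N] [Module k N] [Module Hᵐᵒᵖ N] [IsScalarTower k Hᵐᵒᵖ N]

/-- The action of `H` on `M ⊗ N` for right modules, `(m ⊗ n) h = ∑ m h₍₁₎ ⊗ n h₍₂₎`. -/
noncomputable def rightTensorAction : Hᵐᵒᵖ →ₐ[k] Module.End k (M ⊗[k] N) :=
  (Module.endTensorEndAlgHom (R := k) (S := k) (A := k) (M := M) (N := N)).comp <|
    (Algebra.TensorProduct.map (Algebra.lsmul k k M : Hᵐᵒᵖ →ₐ[k] Module.End k M)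
      (Algebra.lsmul k k N : Hᵐᵒᵖ →ₐ[k] Module.End k N)).comp <|
    ((Algebra.TensorProduct.opAlgEquiv k k H H).symm : (H ⊗[k] H)ᵐᵒᵖ →ₐ[k] Hᵐᵒᵖ ⊗[k] Hᵐᵒᵖ).comp <|
    AlgHom.op (Bialgebra.comulAlgHom k H)

noncomputable instance : AddCommGroup (RightTensor k H M N) :=
  inferInstanceAs (AddCommGroup (M ⊗[k] N))

noncomputable instance : Module k (RightTensor k H M N) :=
  inferInstanceAs (Module k (M ⊗[k] N))

noncomputable instance : Module Hᵐᵒᵖ (RightTensor k H M N) :=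
  Module.compHom (M ⊗[k] N) (rightTensorAction k H M N).toRingHom

end RightTensor

/-! ### The half quantum group (Taft algebra) -/

/-- The two generators: `b` is group-like and `a` is nilpotent. -/
inductive TaftGen : Type
  | a | b

/-- Relations `a ^ n = 0`, `b ^ n = 1`, `b a = q a b`. -/
inductive TaftRel (k : Type u) [Field k] (n : ℕ) (q : k) :
    FreeAlgebra k TaftGen → FreeAlgebra k TaftGen → Prop
  | a_pow : TaftRel k n q (FreeAlgebra.ι k .a ^ n) 0
  | b_pow : TaftRel k n q (FreeAlgebra.ι k .b ^ n) 1
  | b_mul_a : TaftRel k n q (FreeAlgebra.ι k .b * FreeAlgebra.ι k .a)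
      (q • (FreeAlgebra.ι k .a * FreeAlgebra.ι k .b))

/-- `U_n(q) = k⟨a, b | a ^ n = 0, b ^ n = 1, b a = q a b⟩`. -/
def Taft (k : Type u) [Field k] (n : ℕ) (q : k) : Type u := RingQuot (TaftRel k n q)

namespace Taft

variable (k : Type u) [Field k] (n : ℕ) (q : k)

noncomputable instance : Ring (Taft k n q) := inferInstanceAs (Ring (RingQuot (TaftRel k n q)))

noncomputable instance : Algebra k (Taft k n q) :=
  inferInstanceAs (Algebra k (RingQuot (TaftRel k n q)))

/-- The image of a generator. -/
noncomputable def gen (x : TaftGen) : Taft k n q :=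
  RingQuot.mkAlgHom k (TaftRel k n q) (FreeAlgebra.ι k x)

/-- The nilpotent generator. -/
noncomputable def a : Taft k n q := gen k n q .a

/-- The group-like generator. -/
noncomputable def b : Taft k n q := gen k n q .b

theorem a_pow : a k n q ^ n = 0 := by
  have h := RingQuot.mkAlgHom_rel k (TaftRel.a_pow (k := k) (n := n) (q := q))
  rw [map_pow, map_zero] at h
  exact h

theorem b_pow : b k n q ^ n = 1 := by
  have h := RingQuot.mkAlgHom_rel k (TaftRel.b_pow (k := k) (n := n) (q := q))
  rw [map_pow, map_one] at h
  exact h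

theorem b_mul_a : b k n q * a k n q = q • (a k n q * b k n q) := by
  have h := RingQuot.mkAlgHom_rel k (TaftRel.b_mul_a (k := k) (n := n) (q := q))
  rw [map_mul, map_smul, map_mul] at h
  exact h

variable {k n q}

/-- The universal property of `U_n(q)`. -/
noncomputable def lift {B : Type*} [Ring B] [Algebra k B] (x y : B)
    (hx : x ^ n = 0) (hy : y ^ n = 1) (hyx : y * x = q • (x * y)) : Taft k n q →ₐ[k] B :=
  RingQuot.liftAlgHom k ⟨FreeAlgebra.lift k (fun g => TaftGen.casesOn g x y), by
    intro s t h
    cases h <;> simp [hx, hy, hyx]⟩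

section

variable {B : Type*} [Ring B] [Algebra k B] {x y : B}
    {hx : x ^ n = 0} {hy : y ^ n = 1} {hyx : y * x = q • (x * y)}

@[simp] theorem lift_a : lift x y hx hy hyx (a k n q) = x := by
  unfold lift a gen
  erw [RingQuot.liftAlgHom_mkAlgHom_apply]
  simp

@[simp] theorem lift_b : lift x y hx hy hyx (b k n q) = y := by
  unfold lift b gen
  erw [RingQuot.liftAlgHom_mkAlgHom_apply]
  simp

theorem algHom_ext {f g : Taft k n q →ₐ[k] B} (ha : f (a k n q) = g (a k n q))
    (hb : f (b k n q) = g (b k n q)) : f = g := by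
  apply RingQuot.ringQuot_ext'
  apply FreeAlgebra.hom_ext
  funext i
  cases i
  · exact ha
  · exact hb

end

/-- Gaussian binomial coefficients, `(m choose j)_q`. -/
def gauss (q : k) : ℕ → ℕ → k
  | _, 0 => 1
  | 0, _ + 1 => 0
  | m + 1, j + 1 => q ^ (j + 1) * gauss q m (j + 1) + gauss q m j

theorem gauss_zero_right (q : k) (m : ℕ) : gauss q m 0 = 1 := by
  cases m <;> rfl

theorem gauss_eq_zero (q : k) : ∀ m j : ℕ, m < j → gauss q m j = 0
  | _, 0, h => absurd h (Nat.not_lt_zero _)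
  | 0, _ + 1, _ => rfl
  | m + 1, j + 1, h => by
    rw [gauss, gauss_eq_zero q m (j + 1) (by omega), gauss_eq_zero q m j (by omega)]
    simp

theorem gauss_self (q : k) : ∀ m : ℕ, gauss q m m = 1
  | 0 => rfl
  | m + 1 => by
    rw [gauss, gauss_self q m, gauss_eq_zero q m (m + 1) (by omega)]
    simp

theorem gauss_step (q : k) : ∀ m j : ℕ,
    (q ^ j - q ^ j * q ^ (j + 1)) * gauss q m (j + 1) = (q ^ j - q ^ m) * gauss q m j
  | 0, 0 => by simp [gauss]
  | 0, j + 1 => by simp [gauss]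
  | m + 1, 0 => by
    have h := gauss_step q m 0
    rw [gauss.eq_3 q m 0]
    simp only [gauss_zero_right] at h ⊢
    linear_combination q * h
  | m + 1, j + 1 => by
    have h1 := gauss_step q m (j + 1)
    have h2 := gauss_step q m j
    rw [gauss.eq_3 q m (j + 1), gauss.eq_3 q m j]
    linear_combination (q ^ (j + 1 + 1)) * h1 + q * h2

theorem gauss_vanish {q : k} {n : ℕ} (hq : IsPrimitiveRoot q n) (hn : n ≠ 0) :
    ∀ j : ℕ, j + 1 < n → gauss q n (j + 1) = 0
  | j, hj => by
    have h := gauss_step q n j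
    have hq0 : q ≠ 0 := hq.ne_zero hn
    have h1 : q ^ j - q ^ j * q ^ (j + 1) ≠ 0 := by
      rw [← mul_one_sub]
      refine mul_ne_zero (pow_ne_zero _ hq0) (sub_ne_zero.2 (Ne.symm ?_))
      exact hq.pow_ne_one_of_pos_of_lt (by omega) hj
    have h2 : (q ^ j - q ^ n) * gauss q n j = 0 := by
      cases j with
      | zero => simp [hq.pow_eq_one]
      | succ j => rw [gauss_vanish hq hn j (by omega), mul_zero]
    rw [h2] at h
    exact (mul_eq_zero.1 h).resolve_left h1

/-- The `q`-binomial theorem. -/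
theorem add_pow_gauss {B : Type*} [Ring B] [Algebra k B] (u v : B) (h : u * v = q • (v * u))
    (m : ℕ) :
    (u + v) ^ m = ∑ j ∈ Finset.range (m + 1), gauss q m j • (v ^ j * u ^ (m - j)) := by
  have huv : ∀ j : ℕ, u * v ^ j = q ^ j • (v ^ j * u) := by
    intro j
    induction j with
    | zero => simp
    | succ j ih =>
      rw [pow_succ, ← mul_assoc, ih, smul_mul_assoc, mul_assoc, h, mul_smul_comm, smul_smul,
        ← mul_assoc, pow_succ]
  induction m with
  | zero => simp [gauss]
  | succ m ih =>
    rw [pow_succ', ih, add_mul, Finset.mul_sum, Finset.mul_sum, Finset.sum_range_succ' _ (m + 1)]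
    simp only [gauss, add_smul, Finset.sum_add_distrib]
    have e1 : ∑ j ∈ Finset.range (m + 1), u * gauss q m j • (v ^ j * u ^ (m - j))
        = ∑ j ∈ Finset.range (m + 1 + 1), (q ^ j * gauss q m j) • (v ^ j * u ^ (m + 1 - j)) := by
      rw [Finset.sum_range_succ _ (m + 1), gauss_eq_zero q m (m + 1) (by omega), mul_zero,
        zero_smul, add_zero]
      refine Finset.sum_congr rfl fun j hj => ?_
      have hj' : m + 1 - j = (m - j) + 1 := by
        have := Finset.mem_range.1 hj
        omega
      rw [mul_smul_comm, ← mul_assoc, huv, smul_mul_assoc, smul_smul, mul_comm, hj', pow_succ',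
        mul_assoc]
    have e2 : ∑ j ∈ Finset.range (m + 1), v * gauss q m j • (v ^ j * u ^ (m - j))
        = ∑ j ∈ Finset.range (m + 1), gauss q m j • (v ^ (j + 1) * u ^ (m + 1 - (j + 1))) := by
      refine Finset.sum_congr rfl fun j _ => ?_
      rw [mul_smul_comm, ← mul_assoc, ← pow_succ', Nat.add_sub_add_right]
    rw [e1, e2, Finset.sum_range_succ' _ (m + 1)]
    simp only [gauss_zero_right, pow_zero, one_mul]
    abel

theorem add_pow_eq_zero {B : Type*} [Ring B] [Algebra k B] {u v : B} (h : u * v = q • (v * u))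
    (hn : n ≠ 0) (hq : IsPrimitiveRoot q n) (hu : u ^ n = 0) (hv : v ^ n = 0) :
    (u + v) ^ n = 0 := by
  rw [add_pow_gauss u v h]
  refine Finset.sum_eq_zero fun j hj => ?_
  have hj := Finset.mem_range.1 hj
  rcases j with _ | j
  · simp [hu]
  · rcases Nat.lt_or_ge (j + 1) n with h1 | h1
    · rw [gauss_vanish hq hn j h1, zero_smul]
    · have : j + 1 = n := by omega
      rw [this, hv]
      simp

section Bialgebra

variable [hn : Fact (2 ≤ n)] [hq : Fact (IsPrimitiveRoot q n)]

variable (k n q) in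
/-- `ε(a) = 0` and `ε(b) = 1`. -/
noncomputable def counitHom : Taft k n q →ₐ[k] k :=
  lift 0 1 (zero_pow (by have := hn.out; omega)) (one_pow n) (by simp)

variable (k n q) in
/-- `Δ(a) = a ⊗ b + 1 ⊗ a` and `Δ(b) = b ⊗ b`. -/
noncomputable def comulHom : Taft k n q →ₐ[k] Taft k n q ⊗[k] Taft k n q :=
  lift (a k n q ⊗ₜ[k] b k n q + 1 ⊗ₜ[k] a k n q) (b k n q ⊗ₜ[k] b k n q)
    (by
      refine add_pow_eq_zero (q := q) ?_ (by have := hn.out; omega) hq.out ?_ ?_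
      · simp [Algebra.TensorProduct.tmul_mul_tmul, b_mul_a, TensorProduct.tmul_smul]
      · simp [Algebra.TensorProduct.tmul_pow, a_pow]
      · simp [Algebra.TensorProduct.tmul_pow, a_pow])
    (by
      simp [Algebra.TensorProduct.tmul_pow, b_pow, Algebra.TensorProduct.one_def])
    (by
      simp [mul_add, add_mul, Algebra.TensorProduct.tmul_mul_tmul, b_mul_a,
        TensorProduct.tmul_smul, TensorProduct.smul_tmul'])

/-- The bialgebra structure of `U_n(q)`. -/
noncomputable instance : Bialgebra k (Taft k n q) :=
  Bialgebra.ofAlgHom (comulHom k n q) (counitHom k n q)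
    (by
      apply algHom_ext
      · simp [comulHom, TensorProduct.add_tmul, TensorProduct.tmul_add,
          Algebra.TensorProduct.one_def, add_assoc]
      · simp [comulHom])
    (by
      apply algHom_ext
      · simp [comulHom, counitHom]
      · simp [comulHom, counitHom])
    (by
      apply algHom_ext
      · simp [comulHom, counitHom]
      · simp [comulHom, counitHom])

end Bialgebra

/-! ### The indecomposable modules `M(ℓ, i)` -/

variable (k n q)

/-- The idempotent `e_i = (1 / n) ∑_{j < n} q ^ ((i - 1) j) b ^ j`, where `i` matters mod `n`. -/
noncomputable def idem (i : ℤ) : Taft k n q :=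
  (n : k)⁻¹ • ∑ j ∈ Finset.range n, q ^ ((i - 1) * (j : ℤ)) • b k n q ^ j

/-- The right ideal `P_i J ^ r = e_i U_n(q) a ^ r U_n(q) = e_i a ^ r U_n(q)`; here
`J = a U_n(q) = U_n(q) a` is the radical and `P_i = e_i U_n(q)`. -/
noncomputable def PJ (i : ℤ) (r : ℕ) : Submodule (Taft k n q)ᵐᵒᵖ (Taft k n q) :=
  Submodule.span _ {idem k n q i * a k n q ^ r}

/-- The right module `M(ℓ, i) = P_{ℓ - i + 1} J ^ (n - ℓ)`, of length `ℓ`. -/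
noncomputable abbrev Indec (l : ℕ) (i : ℤ) : Submodule (Taft k n q)ᵐᵒᵖ (Taft k n q) :=
  PJ k n q (l - i + 1) (n - l)

end Taft

/-! ### The quantum double -/

/-- The four generators of the quantum double. -/
inductive DoubleGen : Type
  | a | b | c | d

section Double

variable (k : Type u) [Field k] (n : ℕ) (q : k)

local notation "α" => FreeAlgebra.ι k DoubleGen.a
local notation "β" => FreeAlgebra.ι k DoubleGen.b
local notation "γ" => FreeAlgebra.ι k DoubleGen.c
local notation "δ" => FreeAlgebra.ι k DoubleGen.d

/-- The relations of the quantum double of `U_n(q)`. -/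
inductive DoubleRel : FreeAlgebra k DoubleGen → FreeAlgebra k DoubleGen → Prop
  | a_pow : DoubleRel (α ^ n) 0
  | d_pow : DoubleRel (δ ^ n) 0
  | b_pow : DoubleRel (β ^ n) 1
  | c_pow : DoubleRel (γ ^ n) 1
  | b_mul_a : DoubleRel (β * α) (q • (α * β))
  | d_mul_c : DoubleRel (δ * γ) (q • (γ * δ))
  | d_mul_b : DoubleRel (δ * β) (q • (β * δ))
  | b_mul_c : DoubleRel (β * γ) (γ * β)
  | c_mul_a : DoubleRel (γ * α) (q • (α * γ))
  | d_mul_a : DoubleRel (δ * α - q • (α * δ)) (1 - β * γ)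

/-- The quantum double `D(U_n(q))`, by generators and relations. -/
def QuantumDouble : Type u := RingQuot (DoubleRel k n q)

end Double

namespace QuantumDouble

variable (k : Type u) [Field k] (n : ℕ) (q : k)

noncomputable instance : Ring (QuantumDouble k n q) :=
  inferInstanceAs (Ring (RingQuot (DoubleRel k n q)))

noncomputable instance : Algebra k (QuantumDouble k n q) :=
  inferInstanceAs (Algebra k (RingQuot (DoubleRel k n q)))

/-- The image of a generator. -/
noncomputable def gen (x : DoubleGen) : QuantumDouble k n q :=
  RingQuot.mkAlgHom k (DoubleRel k n q) (FreeAlgebra.ι k x)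

theorem a_pow : gen k n q .a ^ n = 0 := by
  have h := RingQuot.mkAlgHom_rel k (DoubleRel.a_pow (k := k) (n := n) (q := q))
  rw [map_pow, map_zero] at h
  exact h

theorem b_pow : gen k n q .b ^ n = 1 := by
  have h := RingQuot.mkAlgHom_rel k (DoubleRel.b_pow (k := k) (n := n) (q := q))
  rw [map_pow, map_one] at h
  exact h

theorem b_mul_a : gen k n q .b * gen k n q .a = q • (gen k n q .a * gen k n q .b) := by
  have h := RingQuot.mkAlgHom_rel k (DoubleRel.b_mul_a (k := k) (n := n) (q := q))
  rw [map_mul, map_smul, map_mul] at h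
  exact h

/-- The embedding `U_n(q) → D(U_n(q))` that sends `a` to `a` and `b` to `b`. -/
noncomputable def ofTaft : Taft k n q →ₐ[k] QuantumDouble k n q :=
  Taft.lift (gen k n q .a) (gen k n q .b) (a_pow k n q) (b_pow k n q) (b_mul_a k n q)

variable [Fact (2 ≤ n)] [Fact (IsPrimitiveRoot q n)]

/-- The right ideal `R⁺ D` of `D = D(U_n(q))` generated by the augmentation ideal `R⁺ = ker ε`
of `R = U_n(q)`. -/
noncomputable def augmentationRightIdeal :
    Submodule (QuantumDouble k n q)ᵐᵒᵖ (QuantumDouble k n q) :=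
  Submodule.span _ (ofTaft k n q '' {r | Coalgebra.counit (R := k) r = 0})

/-- The quotient module `Q = D / R⁺ D`. -/
def Q : Type u := QuantumDouble k n q ⧸ augmentationRightIdeal k n q

noncomputable instance : AddCommGroup (Q k n q) :=
  inferInstanceAs (AddCommGroup (QuantumDouble k n q ⧸ augmentationRightIdeal k n q))

noncomputable instance : Module k (Q k n q) :=
  inferInstanceAs (Module k (QuantumDouble k n q ⧸ augmentationRightIdeal k n q))

/-- `Q` is a right `U_n(q)`-module by restriction of its right `D`-module structure. -/
noncomputable instance : Module (Taft k n q)ᵐᵒᵖ (Q k n q) :=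
  Module.compHom (QuantumDouble k n q ⧸ augmentationRightIdeal k n q)
    (AlgHom.op (ofTaft k n q)).toRingHom

noncomputable instance : IsScalarTower k (Taft k n q)ᵐᵒᵖ (Q k n q) where
  smul_assoc c x y := by
    change (AlgHom.op (ofTaft k n q)) (c • x) •
        (show QuantumDouble k n q ⧸ augmentationRightIdeal k n q from y) =
      c • ((AlgHom.op (ofTaft k n q)) x •
        (show QuantumDouble k n q ⧸ augmentationRightIdeal k n q from y))
    rw [map_smul, smul_assoc]

/-- `Q ⊗ Q` as a right `U_n(q)`-module. -/
abbrev QQ : Type u := RightTensor k (Taft k n q) (Q k n q) (Q k n q)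

end QuantumDouble

/-!
A right `U_n(q)`-module is a vector space with two operators, `v ↦ v a` and `v ↦ v b`. The second is
diagonalizable, because `n` is invertible in `k`, and the first shifts its eigenvalues by `q⁻¹`.

*Classification.* A string module (`IsString`) is generated by a `b`-eigenvector `g` with
`g a ^ r ≠ 0 = g a ^ (r + 1)`. It is determined up to isomorphism by `r` and the eigenvalue `ζ` of
`g`, it is indecomposable because `g a ^ r` lies in every nonzero submodule, and `M(x, y)` is the
string module with `r = x - 1` and `ζ = q ^ y` (`isString_Indec`). A `b`-eigenvector `w` of any
module with `w a ^ (r + 1) = 0` and `w a ^ r ∉ M a ^ (r + 1)` generates a string module that is a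
direct summand (`HasString.exists_isCompl`): a linear form `φ`, itself an eigenvector of `b`, that
vanishes on `M a ^ (r + 1)` but not at `w a ^ r` provides the complement
`{v | ∀ i, φ (v a ^ i) = 0}`.
If `r` is the largest number with `M a ^ r ≠ 0`, such a `w` exists; so every indecomposable module,
of whatever dimension, is a string module. The existence of `w` (`HasString`) also passes from a
direct sum to one of its summands, which replaces the uniqueness part of the Krull–Schmidt theorem.

*The module `Q`.* The classes of `c ^ i d ^ j` span `Q`. After the left factor `c` is diagonalized,
with eigenvalue `τ`, one gets chains `u_0, …, u_(n - 1)` with `u_j b = q ^ j u_j` and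
`u_(j + 1) a = (j + 1)_q (1 - q ^ j τ) u_j`. A right `D`-module with such a basis shows that the
chain does not collapse. The zero of `1 - q ^ j τ` cuts it into two strings, so that `Q` contains
split strings of all lengths `≤ n` with top eigenvalue `q ^ (length - 1)`, and also with `q ^ (n - 1)`.

*The tensor product.* In the Clebsch–Gordan decomposition of the product of two strings only the two
extreme constituents are needed. For the longest one (`HasString.rightTensor_top`) the products of
the generators and of the linear forms do, by the `q`-binomial theorem. For the shortest one
(`HasString.rightTensor_bot`) the action of `a` between consecutive degrees is given by one
triangular matrix `L` with `L ^ n = 1`; its invertibility gives the generator, and its powers give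
the linear form. Together they produce every length and every eigenvalue (`hasString_QQ`).
-/

namespace Taft

/-! ### Spectral projections of an element of finite order -/

section SpecProj

variable {k : Type u} [Field k] {n : ℕ} {R : Type*} [Ring R] [Algebra k R]

/-- The projection `n⁻¹ ∑_{j < n} τ ^ (-j) x ^ j` onto the `τ`-eigenspace of an element `x` with
`x ^ n = 1`, where `τ ^ n = 1`. -/
noncomputable def specProj (n : ℕ) (x : R) (τ : k) : R :=
  (n : k)⁻¹ • ∑ j ∈ Finset.range n, (τ ^ j)⁻¹ • x ^ j

theorem specProj_mul {x : R} {τ : k} (hn : n ≠ 0) (hx : x ^ n = 1) (hτ : τ ^ n = 1) :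
    specProj n x τ * x = τ • specProj n x τ := by
  have hτ0 : τ ≠ 0 := by rintro rfl; simp [zero_pow hn] at hτ
  unfold specProj
  rw [smul_mul_assoc, smul_comm τ]
  congr 1
  rw [Finset.sum_mul, Finset.smul_sum]
  have h := Finset.sum_range_succ' (fun j => (τ * (τ ^ j)⁻¹) • x ^ j) n
  have h' := Finset.sum_range_succ (fun j => (τ * (τ ^ j)⁻¹) • x ^ j) n
  simp only [hx, hτ, pow_zero] at h h'
  rw [h', add_left_inj] at h
  simp only [smul_smul]
  rw [h]
  refine Finset.sum_congr rfl fun j _ => ?_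
  rw [smul_mul_assoc, ← pow_succ]
  congr 1
  field_simp
  rw [pow_succ]

theorem mul_specProj {x : R} {τ : k} (hn : n ≠ 0) (hx : x ^ n = 1) (hτ : τ ^ n = 1) :
    x * specProj n x τ = τ • specProj n x τ := by
  rw [← specProj_mul hn hx hτ]
  unfold specProj
  rw [mul_smul_comm, smul_mul_assoc, Finset.sum_mul, Finset.mul_sum]
  simp only [mul_smul_comm, smul_mul_assoc, ← pow_succ, ← pow_succ']

variable {q : k} (hq : IsPrimitiveRoot q n)
include hq

theorem cast_ne_zero_of_isPrimitiveRoot (hn : n ≠ 0) : (n : k) ≠ 0 :=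
  haveI : NeZero n := ⟨hn⟩
  (hq.neZero' (R := k)).out

theorem sum_specProj (hn : n ≠ 0) (x : R) :
    ∑ y ∈ Finset.range n, specProj n x (q ^ y) = 1 := by
  have hq0 : q ≠ 0 := hq.ne_zero hn
  unfold specProj
  rw [← Finset.smul_sum, Finset.sum_comm]
  rw [Finset.sum_eq_single 0]
  · simp only [pow_zero, inv_one, one_smul, Finset.sum_const, Finset.card_range]
    rw [← Nat.cast_smul_eq_nsmul k, smul_smul,
      inv_mul_cancel₀ (cast_ne_zero_of_isPrimitiveRoot hq hn), one_smul]
  · intro j hj hj0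
    have hj := Finset.mem_range.1 hj
    rw [← Finset.sum_smul]
    have h1 : (q ^ j)⁻¹ ≠ 1 := by
      rw [Ne, inv_eq_one]
      exact hq.pow_ne_one_of_pos_of_lt hj0 hj
    have h2 : ((q ^ j)⁻¹) ^ n = 1 := by
      rw [inv_pow, ← pow_mul, mul_comm, pow_mul, hq.pow_eq_one, one_pow, inv_one]
    have h3 : ∑ y ∈ Finset.range n, ((q ^ y) ^ j)⁻¹ = 0 := by
      have h4 := geom_sum_mul ((q ^ j)⁻¹) n
      rw [h2, sub_self, mul_eq_zero, sub_eq_zero] at h4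
      rw [← h4.resolve_right h1]
      refine Finset.sum_congr rfl fun y _ => ?_
      rw [inv_pow, ← pow_mul, ← pow_mul, mul_comm]
    rw [h3, zero_smul]
  · intro h
    exact absurd (Finset.mem_range.2 (Nat.pos_of_ne_zero hn)) h

end SpecProj

theorem gauss_ne_zero {k : Type u} [Field k] {q : k} {n : ℕ} (hq : IsPrimitiveRoot q n) {m : ℕ}
    (hm : m < n) : ∀ j : ℕ, j ≤ m → gauss q m j ≠ 0
  | 0, _ => by simp [gauss_zero_right]
  | j + 1, hj => by
    intro h0
    have h := gauss_step q m j
    rw [h0, mul_zero, eq_comm, mul_eq_zero] at h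
    refine h.elim (fun h => ?_) (gauss_ne_zero hq hm j (by omega))
    have := hq.pow_inj (by omega) hm (sub_eq_zero.1 h)
    omega

/-! ### The two operators of a right module -/

section Act

variable (k : Type u) [Field k] (n : ℕ) (q : k)
variable (M : Type*) [AddCommGroup M] [Module k M] [Module (Taft k n q)ᵐᵒᵖ M]
  [IsScalarTower k (Taft k n q)ᵐᵒᵖ M]

/-- The operator `v ↦ v a` of a right module. -/
noncomputable def actA : Module.End k M := Algebra.lsmul k k M (op (a k n q))

/-- The operator `v ↦ v b` of a right module. -/
noncomputable def actB : Module.End k M := Algebra.lsmul k k M (op (b k n q))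

variable {M} in
theorem op_a_smul (v : M) : op (a k n q) • v = actA k n q M v := rfl

variable {M} in
theorem op_b_smul (v : M) : op (b k n q) • v = actB k n q M v := rfl

theorem actA_pow : actA k n q M ^ n = 0 := by
  rw [actA, ← map_pow, ← op_pow, a_pow, op_zero, map_zero]

theorem actB_pow : actB k n q M ^ n = 1 := by
  rw [actB, ← map_pow, ← op_pow, b_pow, op_one, map_one]

theorem actA_mul_actB : actA k n q M * actB k n q M = q • (actB k n q M * actA k n q M) := by
  rw [actA, actB, ← map_mul, ← map_mul, ← op_mul, ← op_mul, b_mul_a, op_smul, map_smul]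

theorem actA_pow_mul_actB (m : ℕ) :
    actA k n q M ^ m * actB k n q M = q ^ m • (actB k n q M * actA k n q M ^ m) := by
  induction m with
  | zero => simp
  | succ m ih =>
    rw [pow_succ', mul_assoc, ih, mul_smul_comm, ← mul_assoc, actA_mul_actB, smul_mul_assoc,
      smul_smul, mul_assoc, pow_succ]

variable {M}

theorem actA_pow_actB (m : ℕ) (v : M) :
    (actA k n q M ^ m) (actB k n q M v) = q ^ m • actB k n q M ((actA k n q M ^ m) v) :=
  congrArg (fun f : Module.End k M => f v) (actA_pow_mul_actB k n q M m)

theorem actA_pow_eq_zero {m : ℕ} (hm : n ≤ m) (v : M) : (actA k n q M ^ m) v = 0 := by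
  rw [← Nat.sub_add_cancel hm, pow_add, actA_pow, mul_zero, LinearMap.zero_apply]

theorem actA_pow_eq_zero_of_le {m m' : ℕ} (h : m ≤ m') {v : M} (hv : (actA k n q M ^ m) v = 0) :
    (actA k n q M ^ m') v = 0 := by
  rw [← Nat.sub_add_cancel h, pow_add, Module.End.mul_apply, hv, map_zero]

/-- Multiplication by `a ^ m` divides the `b`-eigenvalue by `q ^ m`. -/
theorem actB_actA_pow (hq : q ≠ 0) {ζ : k} {v : M} (hv : actB k n q M v = ζ • v) (m : ℕ) :
    actB k n q M ((actA k n q M ^ m) v) = (ζ / q ^ m) • (actA k n q M ^ m) v := by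
  have h := actA_pow_actB k n q m v
  rw [hv, map_smul] at h
  rw [div_eq_inv_mul, mul_smul, h, smul_smul, inv_mul_cancel₀ (pow_ne_zero _ hq), one_smul]

variable {N : Type*} [AddCommGroup N] [Module k N] [Module (Taft k n q)ᵐᵒᵖ N]
  [IsScalarTower k (Taft k n q)ᵐᵒᵖ N]

theorem map_actA_pow (f : M →ₗ[(Taft k n q)ᵐᵒᵖ] N) (m : ℕ) (v : M) :
    f ((actA k n q M ^ m) v) = (actA k n q N ^ m) (f v) := by
  induction m generalizing v with
  | zero => simp
  | succ m ih =>
    rw [pow_succ, pow_succ, Module.End.mul_apply, Module.End.mul_apply, ih, ← op_a_smul,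
      ← op_a_smul, map_smul]

theorem map_actB (f : M →ₗ[(Taft k n q)ᵐᵒᵖ] N) (v : M) :
    f (actB k n q M v) = actB k n q N (f v) := by
  rw [← op_b_smul, ← op_b_smul, map_smul]

theorem map_smul_of_tower (f : M →ₗ[(Taft k n q)ᵐᵒᵖ] N) (c : k) (v : M) : f (c • v) = c • f v := by
  rw [← one_smul (Taft k n q)ᵐᵒᵖ v, ← smul_assoc, map_smul, map_smul, one_smul, smul_assoc,
    one_smul]

variable {k n q}

/-- `U_n(q)` is generated by `a` and `b`. -/
theorem induction {p : Taft k n q → Prop} (hk : ∀ c : k, p (algebraMap k _ c)) (ha : p (a k n q))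
    (hb : p (b k n q)) (hadd : ∀ x y, p x → p y → p (x + y)) (hmul : ∀ x y, p x → p y → p (x * y))
    (x : Taft k n q) : p x := by
  obtain ⟨z, rfl⟩ := RingQuot.mkAlgHom_surjective k (TaftRel k n q) x
  induction z using FreeAlgebra.induction with
  | grade0 r =>
    rw [AlgHom.commutes]
    exact hk r
  | grade1 g => cases g <;> assumption
  | mul x y hx hy =>
    rw [map_mul]
    exact hmul _ _ hx hy
  | add x y hx hy =>
    rw [map_add]
    exact hadd _ _ hx hy

/-- A subspace of a right module that `a` and `b` preserve, as a submodule. -/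
def stableSubmodule (S : Submodule k M) (hA : ∀ v ∈ S, actA k n q M v ∈ S)
    (hB : ∀ v ∈ S, actB k n q M v ∈ S) : Submodule (Taft k n q)ᵐᵒᵖ M where
  carrier := S
  zero_mem' := S.zero_mem
  add_mem' := S.add_mem
  smul_mem' := by
    intro x
    induction x using MulOpposite.rec' with | _ x =>
    induction x using Taft.induction with
    | hk c =>
      intro v hv
      change op (algebraMap k (Taft k n q) c) • v ∈ S
      have h : op (algebraMap k (Taft k n q) c) = c • (1 : (Taft k n q)ᵐᵒᵖ) := by
        rw [Algebra.algebraMap_eq_smul_one, op_smul, op_one]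
      rw [h, smul_assoc, one_smul]
      exact S.smul_mem c hv
    | ha => exact fun {v} hv => hA v hv
    | hb => exact fun {v} hv => hB v hv
    | hadd x y hx hy =>
      intro v hv
      rw [op_add, add_smul]
      exact S.add_mem (hx hv) (hy hv)
    | hmul x y hx hy =>
      intro v hv
      rw [op_mul, mul_smul]
      exact hy (hx hv)

end Act

end Taft

namespace Taft

variable (k : Type u) [Field k] (n : ℕ) (q : k)

/-! ### String modules -/

section StringModules

/-- `M` is generated by a `b`-eigenvector `g` of eigenvalue `ζ` such that `g a ^ r ≠ 0` and
`g a ^ (r + 1) = 0`. Then `g, g a, …, g a ^ r` is a basis of `M`, so `M` has length `r + 1`. -/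
def IsString (M : Type*) [AddCommGroup M] [Module k M] [Module (Taft k n q)ᵐᵒᵖ M]
    [IsScalarTower k (Taft k n q)ᵐᵒᵖ M] (r : ℕ) (ζ : k) : Prop :=
  ∃ g : M, actB k n q M g = ζ • g ∧ (actA k n q M ^ (r + 1)) g = 0 ∧ (actA k n q M ^ r) g ≠ 0 ∧
    Submodule.span (Taft k n q)ᵐᵒᵖ {g} = ⊤

variable {k n q}
variable {M : Type*} [AddCommGroup M] [Module k M] [Module (Taft k n q)ᵐᵒᵖ M]
  [IsScalarTower k (Taft k n q)ᵐᵒᵖ M]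
variable {N : Type*} [AddCommGroup N] [Module k N] [Module (Taft k n q)ᵐᵒᵖ N]
  [IsScalarTower k (Taft k n q)ᵐᵒᵖ N]

/-- Applying `a ^ r` to a combination of the `g a ^ j` isolates the coefficient of `g`. -/
theorem actA_pow_sum {r : ℕ} {g : M} (h0 : (actA k n q M ^ (r + 1)) g = 0) {j : ℕ} (hj : j ≤ r)
    {c : ℕ → k} (hc : ∀ i < j, c i = 0) (m : ℕ) :
    (actA k n q M ^ (r - j)) (∑ i ∈ Finset.range m, c i • (actA k n q M ^ i) g)
      = if j < m then c j • (actA k n q M ^ r) g else 0 := by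
  rw [map_sum]
  simp only [map_smul, ← Module.End.mul_apply, ← pow_add]
  have hz : ∀ i, i ≠ j → c i • (actA k n q M ^ (r - j + i)) g = 0 := by
    intro i hi
    rcases Nat.lt_or_gt_of_ne hi with h | h
    · rw [hc i h, zero_smul]
    · rw [actA_pow_eq_zero_of_le k n q (m := r + 1) (by omega) h0, smul_zero]
  split_ifs with h
  · rw [Finset.sum_eq_single j (fun i _ hi => hz i hi)
      (fun h' => absurd (Finset.mem_range.2 h) h'), Nat.sub_add_cancel hj]
  · refine Finset.sum_eq_zero fun i hi => hz i ?_
    have := Finset.mem_range.1 hi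
    omega

theorem eq_zero_of_sum_eq_zero {r : ℕ} {g : M} (h0 : (actA k n q M ^ (r + 1)) g = 0)
    (h1 : (actA k n q M ^ r) g ≠ 0) {c : ℕ → k} {m : ℕ} (hm : r < m)
    (h : ∑ i ∈ Finset.range m, c i • (actA k n q M ^ i) g = 0) (j : ℕ) (hj : j ≤ r) : c j = 0 := by
  induction j using Nat.strong_induction_on with
  | _ j ih =>
    have h' := actA_pow_sum h0 hj (fun i hi => ih i hi (by omega)) m
    rw [h, map_zero, if_pos (by omega), eq_comm, smul_eq_zero] at h'
    exact h'.resolve_right h1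

/-- The submodule generated by a `b`-eigenvector `g` is spanned by the `g a ^ j`. -/
theorem exists_sum_eq_smul (hq : q ≠ 0) {ζ : k} {g : M}
    (hB : actB k n q M g = ζ • g) (x : (Taft k n q)ᵐᵒᵖ) :
    ∃ c : ℕ → k, x • g = ∑ j ∈ Finset.range n, c j • (actA k n q M ^ j) g := by
  let S : Submodule k M :=
    LinearMap.range (Fintype.linearCombination k fun j : Fin n => (actA k n q M ^ (j : ℕ)) g)
  have hmem : ∀ j, (actA k n q M ^ j) g ∈ S := by
    intro j
    rcases lt_or_ge j n with h | h
    · refine ⟨Pi.single ⟨j, h⟩ 1, ?_⟩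
      rw [Fintype.linearCombination_apply_single, one_smul]
    · rw [actA_pow_eq_zero k n q h]
      exact S.zero_mem
  have hA : ∀ v ∈ S, actA k n q M v ∈ S := by
    rintro _ ⟨c, rfl⟩
    rw [Fintype.linearCombination_apply, map_sum]
    refine S.sum_mem fun j _ => ?_
    rw [map_smul, ← Module.End.mul_apply, ← pow_succ']
    exact S.smul_mem _ (hmem _)
  have hB' : ∀ v ∈ S, actB k n q M v ∈ S := by
    rintro _ ⟨c, rfl⟩
    rw [Fintype.linearCombination_apply, map_sum]
    refine S.sum_mem fun j _ => ?_
    rw [map_smul, actB_actA_pow k n q hq hB]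
    exact S.smul_mem _ (S.smul_mem _ (hmem _))
  have hg : g ∈ stableSubmodule S hA hB' := hmem 0
  obtain ⟨c, hc⟩ := (stableSubmodule S hA hB').smul_mem x hg
  refine ⟨fun j => if h : j < n then c ⟨j, h⟩ else 0, ?_⟩
  rw [← hc, Fintype.linearCombination_apply, Finset.sum_range]
  refine Finset.sum_congr rfl fun j _ => ?_
  simp

/-- The annihilator of the generator of a string module depends only on the length and the
eigenvalue. -/
theorem IsString.nonempty_linearEquiv (hq : q ≠ 0) {r : ℕ} (hr : r < n) {ζ : k}
    (hM : IsString k n q M r ζ) (hN : IsString k n q N r ζ) :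
    Nonempty (M ≃ₗ[(Taft k n q)ᵐᵒᵖ] N) := by
  obtain ⟨g, hgB, hg0, hg1, hg⟩ := hM
  obtain ⟨g', hgB', hg0', hg1', hg'⟩ := hN
  -- The pair `(g, g')` is a `b`-eigenvector of the product, so `g x` and `g' x` have the same
  -- coefficients.
  have key : ∀ x : (Taft k n q)ᵐᵒᵖ, ∃ c : ℕ → k,
      x • g = ∑ j ∈ Finset.range n, c j • (actA k n q M ^ j) g ∧
      x • g' = ∑ j ∈ Finset.range n, c j • (actA k n q N ^ j) g' := by
    intro x
    have hB : actB k n q (M × N) (g, g') = ζ • (g, g') := Prod.ext hgB hgB'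
    obtain ⟨c, hc⟩ := exists_sum_eq_smul hq hB x
    refine ⟨c, ?_, ?_⟩
    · have h := congrArg (LinearMap.fst (Taft k n q)ᵐᵒᵖ M N) hc
      rw [map_smul, map_sum] at h
      refine h.trans (Finset.sum_congr rfl fun j _ => ?_)
      rw [map_smul_of_tower, map_actA_pow]
      rfl
    · have h := congrArg (LinearMap.snd (Taft k n q)ᵐᵒᵖ M N) hc
      rw [map_smul, map_sum] at h
      refine h.trans (Finset.sum_congr rfl fun j _ => ?_)
      rw [map_smul_of_tower, map_actA_pow]
      rfl
  have hz : ∀ {c : ℕ → k}, (∀ j ≤ r, c j = 0) →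
      ∑ j ∈ Finset.range n, c j • (actA k n q M ^ j) g = 0 ∧
      ∑ j ∈ Finset.range n, c j • (actA k n q N ^ j) g' = 0 := by
    intro c hc
    constructor <;>
    · refine Finset.sum_eq_zero fun j _ => ?_
      rcases le_or_gt j r with h | h
      · rw [hc j h, zero_smul]
      · rw [actA_pow_eq_zero_of_le k n q (m := r + 1) h (by assumption), smul_zero]
  have hker : LinearMap.ker (LinearMap.toSpanSingleton (Taft k n q)ᵐᵒᵖ M g) =
      LinearMap.ker (LinearMap.toSpanSingleton (Taft k n q)ᵐᵒᵖ N g') := by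
    ext x
    rw [LinearMap.mem_ker, LinearMap.mem_ker, LinearMap.toSpanSingleton_apply,
      LinearMap.toSpanSingleton_apply]
    obtain ⟨c, h1, h2⟩ := key x
    rw [h1, h2]
    exact ⟨fun h => (hz (eq_zero_of_sum_eq_zero hg0 hg1 hr h)).2,
      fun h => (hz (eq_zero_of_sum_eq_zero hg0' hg1' hr h)).1⟩
  have hs : Function.Surjective (LinearMap.toSpanSingleton (Taft k n q)ᵐᵒᵖ M g) := by
    rw [← LinearMap.range_eq_top, LinearMap.range_toSpanSingleton, hg]
  have hs' : Function.Surjective (LinearMap.toSpanSingleton (Taft k n q)ᵐᵒᵖ N g') := by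
    rw [← LinearMap.range_eq_top, LinearMap.range_toSpanSingleton, hg']
  exact ⟨(LinearMap.quotKerEquivOfSurjective _ hs).symm.trans
    ((Submodule.quotEquivOfEq _ _ hker).trans (LinearMap.quotKerEquivOfSurjective _ hs'))⟩

/-- Every nonzero submodule contains the socle `g a ^ r`. -/
theorem IsString.isIndecomposableModule (hq : q ≠ 0) {r : ℕ} (hr : r < n) {ζ : k}
    (hM : IsString k n q M r ζ) : IsIndecomposableModule (Taft k n q)ᵐᵒᵖ M := by
  obtain ⟨g, hgB, hg0, hg1, hg⟩ := hM
  refine ⟨⟨_, _, hg1⟩, fun S T hST => ?_⟩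
  have key : ∀ S : Submodule (Taft k n q)ᵐᵒᵖ M, S ≠ ⊥ → (actA k n q M ^ r) g ∈ S := by
    intro S hS
    obtain ⟨v, hv, hv0⟩ := S.exists_mem_ne_zero_of_ne_bot hS
    have hvg : v ∈ Submodule.span (Taft k n q)ᵐᵒᵖ {g} := hg ▸ Submodule.mem_top
    obtain ⟨x, rfl⟩ := Submodule.mem_span_singleton.1 hvg
    obtain ⟨c, hc⟩ := exists_sum_eq_smul hq hgB x
    have hA : ∀ m, ∀ v ∈ S, (actA k n q M ^ m) v ∈ S := by
      intro m
      induction m with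
      | zero => exact fun v hv => hv
      | succ m ih =>
        intro v hv
        rw [pow_succ, Module.End.mul_apply]
        exact ih _ (S.smul_mem _ hv)
    -- The least `j` with a nonzero coefficient.
    have hex : ∃ j, j ≤ r ∧ c j ≠ 0 := by
      by_contra! hcon
      refine hv0 (hc.trans (Finset.sum_eq_zero fun j _ => ?_))
      rcases le_or_gt j r with h | h
      · rw [hcon j h, zero_smul]
      · rw [actA_pow_eq_zero_of_le k n q (m := r + 1) h hg0, smul_zero]
    classical
    obtain ⟨hj, hj0⟩ := Nat.find_spec hex
    have hlt : ∀ i < Nat.find hex, c i = 0 := by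
      intro i hi
      have h := Nat.find_min hex hi
      push Not at h
      exact h (by omega)
    have h := hA (r - Nat.find hex) _ hv
    rw [hc, actA_pow_sum hg0 hj hlt, if_pos (by omega)] at h
    have h' := S.smul_of_tower_mem (c (Nat.find hex))⁻¹ h
    rwa [smul_smul, inv_mul_cancel₀ hj0, one_smul] at h'
  by_contra! hcon
  exact hg1 (Submodule.disjoint_def.1 hST.disjoint _ (key S hcon.1) (key T hcon.2))

/-- The length and the eigenvalue of a string module are isomorphism invariants. -/
theorem IsString.unique (hq : q ≠ 0) {r r' : ℕ} (hr : r < n) (hr' : r' < n) {ζ ζ' : k}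
    (hM : IsString k n q M r ζ) (hN : IsString k n q N r' ζ') (e : M ≃ₗ[(Taft k n q)ᵐᵒᵖ] N) :
    r = r' ∧ ζ = ζ' := by
  obtain ⟨g, hgB, hg0, hg1, hg⟩ := hM
  obtain ⟨f, hfB, hf0, hf1, hf⟩ := hN
  have key : ∀ v : N, ∃ c : ℕ → k,
      v = ∑ j ∈ Finset.range n, c j • (actA k n q N ^ j) f := by
    intro v
    have hvg : v ∈ Submodule.span (Taft k n q)ᵐᵒᵖ {f} := hf ▸ Submodule.mem_top
    obtain ⟨x, rfl⟩ := Submodule.mem_span_singleton.1 hvg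
    exact exists_sum_eq_smul hq hfB x
  have key' : ∀ v : M, ∃ c : ℕ → k,
      v = ∑ j ∈ Finset.range n, c j • (actA k n q M ^ j) g := by
    intro v
    have hvg : v ∈ Submodule.span (Taft k n q)ᵐᵒᵖ {g} := hg ▸ Submodule.mem_top
    obtain ⟨x, rfl⟩ := Submodule.mem_span_singleton.1 hvg
    exact exists_sum_eq_smul hq hgB x
  have hAN : ∀ v : N, (actA k n q N ^ (r' + 1)) v = 0 := by
    intro v
    obtain ⟨c, rfl⟩ := key v
    rw [map_sum]
    refine Finset.sum_eq_zero fun j _ => ?_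
    rw [map_smul, ← Module.End.mul_apply, ← pow_add,
      actA_pow_eq_zero_of_le k n q (m := r' + 1) (by omega) hf0, smul_zero]
  have hAM : ∀ v : M, (actA k n q M ^ (r + 1)) v = 0 := by
    intro v
    obtain ⟨c, rfl⟩ := key' v
    rw [map_sum]
    refine Finset.sum_eq_zero fun j _ => ?_
    rw [map_smul, ← Module.End.mul_apply, ← pow_add,
      actA_pow_eq_zero_of_le k n q (m := r + 1) (by omega) hg0, smul_zero]
  have hrr : r = r' := by
    apply le_antisymm
    · by_contra! h
      apply hg1
      apply e.injective
      have h2 := map_actA_pow k n q e.toLinearMap r g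
      rw [LinearEquiv.coe_coe] at h2
      rw [h2, map_zero]
      exact actA_pow_eq_zero_of_le k n q h (hAN _)
    · by_contra! h
      apply hf1
      apply e.symm.injective
      have h2 := map_actA_pow k n q e.symm.toLinearMap r' f
      rw [LinearEquiv.coe_coe] at h2
      rw [h2, map_zero]
      exact actA_pow_eq_zero_of_le k n q h (hAM _)
  subst hrr
  refine ⟨rfl, ?_⟩
  -- The socle is spanned by `f a ^ r`, so `(e g) a ^ r` is a multiple of it; compare eigenvalues.
  obtain ⟨c, hc⟩ := key (e g)
  have h1 : (actA k n q N ^ r) (e g) = c 0 • (actA k n q N ^ r) f := by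
    have h := actA_pow_sum hf0 (Nat.zero_le r) (c := c) (by simp) n
    rwa [← hc, if_pos (by omega), Nat.sub_zero] at h
  have h2 : (actA k n q N ^ r) (e g) ≠ 0 := by
    have h2 := map_actA_pow k n q e.toLinearMap r g
    rw [LinearEquiv.coe_coe] at h2
    rw [← h2]
    exact fun h => hg1 (e.injective (h.trans (map_zero e).symm))
  have h3 : actB k n q N (e g) = ζ • e g := by
    have h3 := map_actB k n q e.toLinearMap g
    have h4 := map_smul_of_tower k n q e.toLinearMap ζ g
    rw [LinearEquiv.coe_coe] at h3 h4
    rw [← h3, hgB, h4]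
  have h4 := actB_actA_pow k n q hq h3 r
  have h5 := actB_actA_pow k n q hq hfB r
  rw [h1, map_smul, h5, smul_comm] at h4
  rw [h1] at h2
  have h7 : (ζ' / q ^ r - ζ / q ^ r) • c 0 • (actA k n q N ^ r) f = 0 := by
    rw [sub_smul, sub_eq_zero, h4]
  have h8 := (smul_eq_zero.1 h7).resolve_right h2
  rw [sub_eq_zero, div_left_inj' (pow_ne_zero r hq)] at h8
  exact h8.symm

end StringModules

end Taft

namespace Taft

variable (k : Type u) [Field k] (n : ℕ) (q : k)

/-! ### Split string submodules -/

section HasString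

/-- There is a `b`-eigenvector `w` of eigenvalue `ζ` with `w a ^ (r + 1) = 0` such that `w a ^ r` is
not in `M a ^ (r + 1)`. This holds if and only if the string module of length `r + 1` and
eigenvalue `ζ` is a direct summand of `M`. -/
def HasString (M : Type*) [AddCommGroup M] [Module k M] [Module (Taft k n q)ᵐᵒᵖ M]
    [IsScalarTower k (Taft k n q)ᵐᵒᵖ M] (r : ℕ) (ζ : k) : Prop :=
  ∃ w : M, actB k n q M w = ζ • w ∧ (actA k n q M ^ (r + 1)) w = 0 ∧
    ∀ v : M, (actA k n q M ^ (r + 1)) v ≠ (actA k n q M ^ r) w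

variable {k n q}
variable {M : Type*} [AddCommGroup M] [Module k M] [Module (Taft k n q)ᵐᵒᵖ M]
  [IsScalarTower k (Taft k n q)ᵐᵒᵖ M]

theorem eigenvalue_pow {ζ : k} {w : M} (hw : actB k n q M w = ζ • w) (hw0 : w ≠ 0) :
    ζ ^ n = 1 := by
  have h : ∀ m, (actB k n q M ^ m) w = ζ ^ m • w := by
    intro m
    induction m with
    | zero => simp
    | succ m ih => rw [pow_succ, Module.End.mul_apply, hw, map_smul, ih, smul_smul, pow_succ']
  have h1 := h n
  rw [actB_pow, Module.End.one_apply] at h1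
  have h2 : (ζ ^ n - 1) • w = 0 := by rw [sub_smul, one_smul, ← h1, sub_self]
  exact sub_eq_zero.1 ((smul_eq_zero.1 h2).resolve_right hw0)

/-- The linear form is a `b`-eigenvector, which is what makes its largest `a`-stable null space a
submodule. -/
theorem HasString.exists_dual (hq : IsPrimitiveRoot q n) (hn : n ≠ 0) {r : ℕ} {ζ : k}
    (h : HasString k n q M r ζ) :
    ζ ^ n = 1 ∧ ∃ (w : M) (φ : M →ₗ[k] k), actB k n q M w = ζ • w ∧ (actA k n q M ^ (r + 1)) w = 0 ∧
      φ ((actA k n q M ^ r) w) = 1 ∧ (∀ v, φ ((actA k n q M ^ (r + 1)) v) = 0) ∧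
      ∀ v, φ (actB k n q M v) = (ζ / q ^ r) * φ v := by
  obtain ⟨w, hwB, hw0, hw1⟩ := h
  have hq0 : q ≠ 0 := hq.ne_zero hn
  have hζ : ζ ^ n = 1 := by
    refine eigenvalue_pow hwB ?_
    rintro rfl
    exact hw1 0 (by simp)
  have hξ : (ζ / q ^ r) ^ n = 1 := by
    rw [div_pow, hζ, ← pow_mul, mul_comm, pow_mul, hq.pow_eq_one, one_pow, div_one]
  obtain ⟨f, hf, hfr⟩ := Submodule.exists_le_ker_of_notMem
    (p := LinearMap.range (actA k n q M ^ (r + 1))) (v := (actA k n q M ^ r) w)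
    (by rintro ⟨v, hv⟩; exact hw1 v hv)
  have hA : ∀ v, f ((actA k n q M ^ (r + 1)) v) = 0 := fun v => hfr ⟨v, rfl⟩
  let P : Module.End k M := specProj n (actB k n q M) (ζ / q ^ r)
  have hPB : ∀ v, P (actB k n q M v) = (ζ / q ^ r) • P v := fun v =>
    congrArg (fun g : Module.End k M => g v) (specProj_mul hn (actB_pow k n q M) hξ)
  have hn0 := cast_ne_zero_of_isPrimitiveRoot hq hn
  have hPA : ∀ v, f (P ((actA k n q M ^ (r + 1)) v)) = 0 := by
    intro v
    have hB : ∀ j, ∃ v', (actB k n q M ^ j) ((actA k n q M ^ (r + 1)) v)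
        = (actA k n q M ^ (r + 1)) v' := by
      intro j
      induction j with
      | zero => exact ⟨v, rfl⟩
      | succ j ih =>
        obtain ⟨v', hv'⟩ := ih
        refine ⟨(q ^ (r + 1))⁻¹ • actB k n q M v', ?_⟩
        rw [pow_succ', Module.End.mul_apply, hv', map_smul, actA_pow_actB, smul_smul,
          inv_mul_cancel₀ (pow_ne_zero _ hq0), one_smul]
    simp only [P, specProj, LinearMap.smul_apply, LinearMap.sum_apply, map_smul, map_sum]
    rw [Finset.sum_eq_zero, smul_zero]
    intro j _
    obtain ⟨v', hv'⟩ := hB j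
    rw [hv', hA, smul_zero]
  have hPw : P ((actA k n q M ^ r) w) = (actA k n q M ^ r) w := by
    have hw2 := actB_actA_pow k n q hq0 hwB r
    have hB : ∀ j, (actB k n q M ^ j) ((actA k n q M ^ r) w)
        = (ζ / q ^ r) ^ j • (actA k n q M ^ r) w := by
      intro j
      induction j with
      | zero => simp
      | succ j ih => rw [pow_succ', Module.End.mul_apply, ih, map_smul, hw2, smul_smul, pow_succ]
    have hξ0 : ζ / q ^ r ≠ 0 := by
      intro h
      rw [h, zero_pow hn] at hξ
      exact zero_ne_one hξ
    simp only [P, specProj, LinearMap.smul_apply, LinearMap.sum_apply, hB, smul_smul]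
    simp only [inv_mul_cancel₀ (pow_ne_zero _ hξ0), one_smul, Finset.sum_const, Finset.card_range]
    rw [← Nat.cast_smul_eq_nsmul k, smul_smul, inv_mul_cancel₀ hn0, one_smul]
  refine ⟨hζ, w, (f ((actA k n q M ^ r) w))⁻¹ • (f ∘ₗ P), hwB, hw0, ?_, fun v => ?_, fun v => ?_⟩
  · simp [hPw, hf]
  · simp [hPA]
  · simp only [LinearMap.smul_apply, LinearMap.comp_apply, hPB, map_smul, smul_eq_mul]
    ring

theorem HasString.exists_isCompl (hq : IsPrimitiveRoot q n) (hn : n ≠ 0) {r : ℕ} {ζ : k}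
    (h : HasString k n q M r ζ) :
    ∃ S T : Submodule (Taft k n q)ᵐᵒᵖ M, IsCompl S T ∧ IsString k n q S r ζ := by
  obtain ⟨-, w, φ, hwB, hw0, hφw, hφA, hφB⟩ := h.exists_dual hq hn
  have hq0 : q ≠ 0 := hq.ne_zero hn
  let S := Submodule.span (Taft k n q)ᵐᵒᵖ {w}
  let T₀ : Submodule k M := ⨅ i, LinearMap.ker (φ ∘ₗ (actA k n q M ^ i))
  have hT₀ : ∀ v, v ∈ T₀ ↔ ∀ i, φ ((actA k n q M ^ i) v) = 0 := fun v => by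
    simp [T₀, Submodule.mem_iInf]
  let T := stableSubmodule T₀ (fun v hv => (hT₀ _).2 fun i => by
      rw [← Module.End.mul_apply, ← pow_succ]
      exact (hT₀ _).1 hv (i + 1)) (fun v hv => (hT₀ _).2 fun i => by
      rw [actA_pow_actB, map_smul, hφB, (hT₀ _).1 hv i, mul_zero, smul_zero])
  have hwS : w ∈ S := Submodule.mem_span_singleton_self w
  have hAS : ∀ i, (actA k n q M ^ i) w ∈ S := by
    intro i
    induction i with
    | zero => exact hwS
    | succ i ih =>
      rw [pow_succ', Module.End.mul_apply]
      exact S.smul_mem _ ih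
  have hrn : r < n := by
    by_contra! hcon
    rw [actA_pow_eq_zero k n q hcon, map_zero] at hφw
    exact zero_ne_one hφw
  have hφA' : ∀ i, r < i → ∀ v, φ ((actA k n q M ^ i) v) = 0 := by
    intro i hi v
    obtain ⟨m, rfl⟩ := Nat.exists_eq_add_of_le (Nat.succ_le_of_lt hi)
    rw [pow_add, Module.End.mul_apply, hφA]
  have hφw0 : ∀ i, φ ((actA k n q M ^ i) w) = if i = r then 1 else 0 := by
    intro i
    split_ifs with hi
    · rw [hi, hφw]
    · rcases Nat.lt_or_gt_of_ne hi with h | h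
      · -- The eigenvalues of `w a ^ i` and `φ` differ by `q ^ (r - i) ≠ 1`, unless `w a ^ i = 0`.
        have h1 := hφB ((actA k n q M ^ i) w)
        rw [actB_actA_pow k n q hq0 hwB, map_smul, smul_eq_mul] at h1
        by_contra hne
        have h2 := mul_right_cancel₀ hne h1
        have hw' : w ≠ 0 := by rintro rfl; simp at hne
        have hζ0 : ζ ≠ 0 := by
          rintro rfl
          have := eigenvalue_pow hwB hw'
          rw [zero_pow hn] at this
          exact zero_ne_one this
        rw [div_eq_mul_inv, div_eq_mul_inv, mul_right_inj' hζ0, inv_inj] at h2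
        have := hq.pow_inj (by omega) hrn h2
        omega
      · rw [actA_pow_eq_zero_of_le k n q h hw0, map_zero]
  have hsum : ∀ (c : ℕ → k) (i : ℕ), i ≤ r →
      φ ((actA k n q M ^ i) (∑ j ∈ Finset.range (r + 1), c j • (actA k n q M ^ j) w))
        = c (r - i) := by
    intro c i hi
    simp only [map_sum, map_smul, ← Module.End.mul_apply, ← pow_add, hφw0, smul_eq_mul]
    rw [Finset.sum_eq_single (r - i)]
    · rw [if_pos (by omega), mul_one]
    · intro j _ hj
      rw [if_neg (by omega), mul_zero]
    · intro h
      exact absurd (Finset.mem_range.2 (by omega)) h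
  have hS : ∀ v ∈ S, ∃ c : ℕ → k,
      v = ∑ j ∈ Finset.range (r + 1), c j • (actA k n q M ^ j) w := by
    intro v hv
    obtain ⟨x, rfl⟩ := Submodule.mem_span_singleton.1 hv
    obtain ⟨c, hc⟩ := exists_sum_eq_smul hq0 hwB x
    refine ⟨c, hc.trans (Finset.sum_subset (Finset.range_subset_range.2 hrn) ?_).symm⟩
    intro j _ hj
    rw [Finset.mem_range, not_lt] at hj
    rw [actA_pow_eq_zero_of_le k n q hj hw0, smul_zero]
  refine ⟨S, T, ⟨Submodule.disjoint_def.2 ?_, codisjoint_iff.2 (eq_top_iff.2 ?_)⟩, ?_⟩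
  · intro v hv hvT
    obtain ⟨c, rfl⟩ := hS v hv
    refine Finset.sum_eq_zero fun j hj => ?_
    have hj := Finset.mem_range.1 hj
    have h1 := hsum c (r - j) (by omega)
    rw [(hT₀ _).1 hvT, Nat.sub_sub_self (by omega)] at h1
    rw [← h1, zero_smul]
  · intro v _
    let c : ℕ → k := fun j => φ ((actA k n q M ^ (r - j)) v)
    let s := ∑ j ∈ Finset.range (r + 1), c j • (actA k n q M ^ j) w
    have hs : s ∈ S := S.sum_mem fun j _ => S.smul_of_tower_mem _ (hAS j)
    refine Submodule.mem_sup.2 ⟨s, hs, v - s, (hT₀ _).2 fun i => ?_, add_sub_cancel s v⟩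
    rw [map_sub, map_sub, sub_eq_zero]
    rcases le_or_gt i r with hi | hi
    · rw [hsum c i hi]
      simp only [c]
      rw [Nat.sub_sub_self hi]
    · rw [hφA' i hi, hφA' i hi]
  · have hmap := map_actA_pow k n q S.subtype
    refine ⟨⟨w, hwS⟩, Subtype.ext ?_, Subtype.ext ?_, fun h0 => ?_, ?_⟩
    · exact (map_actB k n q S.subtype _).trans hwB
    · exact (hmap _ _).trans hw0
    · have h1 := hmap r ⟨w, hwS⟩
      rw [h0, map_zero] at h1
      change 0 = (actA k n q M ^ r) w at h1
      rw [← h1, map_zero] at hφw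
      exact zero_ne_one hφw
    · rw [eq_top_iff]
      rintro ⟨v, hv⟩ -
      obtain ⟨x, rfl⟩ := Submodule.mem_span_singleton.1 hv
      exact Submodule.mem_span_singleton.2 ⟨x, rfl⟩

/-- A nonzero module contains a split string, one of maximal length. -/
theorem exists_hasString (hq : IsPrimitiveRoot q n) (hn : n ≠ 0) [Nontrivial M] :
    ∃ r y : ℕ, r < n ∧ y < n ∧ HasString k n q M r (q ^ y) := by
  classical
  have hex : ∃ m, actA k n q M ^ m = 0 := ⟨n, actA_pow k n q M⟩
  have hle : Nat.find hex ≤ n := Nat.find_min' hex (actA_pow k n q M)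
  have hpos : Nat.find hex ≠ 0 := by
    intro h
    have h1 := Nat.find_spec hex
    rw [h, pow_zero] at h1
    exact one_ne_zero h1
  obtain ⟨r, hr⟩ := Nat.exists_eq_succ_of_ne_zero hpos
  have h0 : actA k n q M ^ (r + 1) = 0 := by
    rw [← Nat.succ_eq_add_one, ← hr]
    exact Nat.find_spec hex
  have h1 : actA k n q M ^ r ≠ 0 := Nat.find_min hex (by omega)
  have h2 : ∃ y ∈ Finset.range n, actA k n q M ^ r * specProj n (actB k n q M) (q ^ y) ≠ 0 := by
    by_contra! hcon
    apply h1
    rw [← mul_one (actA k n q M ^ r), ← sum_specProj hq hn (actB k n q M), Finset.mul_sum]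
    exact Finset.sum_eq_zero hcon
  obtain ⟨y, hy, hy0⟩ := h2
  obtain ⟨v, hv⟩ := DFunLike.ne_iff.1 hy0
  refine ⟨r, y, by omega, Finset.mem_range.1 hy, specProj n (actB k n q M) (q ^ y) v, ?_, ?_, ?_⟩
  · exact congrArg (fun f : Module.End k M => f v) (mul_specProj hn (actB_pow k n q M)
      (by rw [← pow_mul, mul_comm, pow_mul, hq.pow_eq_one, one_pow]))
  · rw [h0, LinearMap.zero_apply]
  · intro v' hv'
    rw [h0, LinearMap.zero_apply] at hv'
    exact hv hv'.symm

theorem IsString.congr {N : Type*} [AddCommGroup N] [Module k N] [Module (Taft k n q)ᵐᵒᵖ N]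
    [IsScalarTower k (Taft k n q)ᵐᵒᵖ N] {r : ℕ} {ζ : k} (h : IsString k n q M r ζ)
    (e : M ≃ₗ[(Taft k n q)ᵐᵒᵖ] N) : IsString k n q N r ζ := by
  obtain ⟨g, hB, h0, h1, hg⟩ := h
  have hA := fun m => map_actA_pow k n q e.toLinearMap m g
  have hb := map_actB k n q e.toLinearMap g
  rw [hB, map_smul_of_tower] at hb
  refine ⟨e g, hb.symm, ?_, ?_, ?_⟩
  · exact (hA _).symm.trans (by rw [h0, map_zero])
  · exact fun h => h1 (e.injective (((hA _).trans h).trans (map_zero e).symm))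
  · have h := Submodule.map_span e.toLinearMap {g}
    rw [hg, Submodule.map_top, LinearEquiv.range, Set.image_singleton] at h
    exact h.symm

/-- A split string of an indecomposable module is the whole module. -/
theorem HasString.isString (hq : IsPrimitiveRoot q n) (hn : n ≠ 0) {r : ℕ} {ζ : k}
    (h : HasString k n q M r ζ) (hM : IsIndecomposableModule (Taft k n q)ᵐᵒᵖ M) :
    IsString k n q M r ζ := by
  obtain ⟨S, T, hST, hS⟩ := h.exists_isCompl hq hn
  rcases hM.2 S T hST with rfl | rfl
  · obtain ⟨g, -, -, h1, -⟩ := hS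
    exact absurd (Subsingleton.elim _ _) h1
  · obtain rfl : S = ⊤ := by rw [← hST.sup_eq_top, sup_bot_eq]
    exact hS.congr Submodule.topEquiv

/-- A split string of a direct sum appears in one of the summands. -/
theorem HasString.exists_of_isInternal {ι : Type*} [DecidableEq ι] [Finite ι]
    {V : ι → Submodule (Taft k n q)ᵐᵒᵖ M}
    (hV : DirectSum.IsInternal V) {r : ℕ} {ζ : k} (h : HasString k n q M r ζ) :
    ∃ i, HasString k n q (V i) r ζ := by
  classical
  cases nonempty_fintype ι
  obtain ⟨w, hwB, hw0, hw1⟩ := h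
  let e : (DirectSum ι fun i => V i) ≃ₗ[(Taft k n q)ᵐᵒᵖ] M :=
    LinearEquiv.ofBijective (DirectSum.coeLinearMap V) hV
  let p : ∀ i, M →ₗ[(Taft k n q)ᵐᵒᵖ] V i := fun i =>
    DirectSum.component _ ι _ i ∘ₗ e.symm.toLinearMap
  have hp : ∀ v, ∑ i, (p i v : M) = v := by
    intro v
    obtain ⟨x, rfl⟩ := e.surjective v
    have h1 : ∀ i, p i (e x) = x i := fun i => by
      simp only [p, LinearMap.comp_apply, LinearEquiv.coe_coe, LinearEquiv.symm_apply_apply]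
      rfl
    simp only [h1]
    change _ = DirectSum.coeLinearMap V x
    rw [DirectSum.coeLinearMap_eq_dfinsuppSum, DFinsupp.sum_eq_sum_fintype]
    · rfl
    · exact fun _ => rfl
  by_contra! hcon
  have h1 : ∀ i, ∃ v : V i, (actA k n q (V i) ^ (r + 1)) v = (actA k n q (V i) ^ r) (p i w) := by
    intro i
    by_contra! h
    refine hcon i ⟨p i w, ?_, ?_, h⟩
    · rw [← map_actB, hwB, map_smul_of_tower]
    · rw [← map_actA_pow, hw0, map_zero]
  choose v hv using h1
  apply hw1 (∑ i, (v i : M))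
  rw [map_sum, ← hp w, map_sum]
  refine Finset.sum_congr rfl fun i _ => ?_
  have h2 := congrArg (V i).subtype (hv i)
  rwa [map_actA_pow, map_actA_pow] at h2

end HasString

end Taft

namespace Taft

/-! ### Strings in tensor products -/

section Pure

variable (k : Type u) [Field k] (n : ℕ) (q : k)
variable {M : Type*} [AddCommGroup M] [Module k M] {N : Type*} [AddCommGroup N] [Module k N]

/-- A pure tensor, as an element of the right module `M ⊗ N`. -/
def rtmul (x : M) (y : N) : RightTensor k (Taft k n q) M N := x ⊗ₜ[k] y

/-- The linear form `φ ⊗ ψ` on the right module `M ⊗ N`. -/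
noncomputable def rtForm (φ : M →ₗ[k] k) (ψ : N →ₗ[k] k) :
    RightTensor k (Taft k n q) M N →ₗ[k] k :=
  (LinearMap.mul' k k ∘ₗ TensorProduct.map φ ψ : M ⊗[k] N →ₗ[k] k)

theorem rtForm_rtmul (φ : M →ₗ[k] k) (ψ : N →ₗ[k] k) (x : M) (y : N) :
    rtForm k n q φ ψ (rtmul k n q x y) = φ x * ψ y := by
  change (LinearMap.mul' k k ∘ₗ TensorProduct.map φ ψ : M ⊗[k] N →ₗ[k] k) (x ⊗ₜ[k] y) = _
  simp

theorem rtForm_zero_left (ψ : N →ₗ[k] k) : rtForm k n q (0 : M →ₗ[k] k) ψ = 0 := by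
  unfold rtForm
  rw [TensorProduct.map_zero_left]
  rfl

variable {k n q}

theorem rightTensor_induction {p : RightTensor k (Taft k n q) M N → Prop} (h0 : p 0)
    (ht : ∀ x y, p (rtmul k n q x y)) (hadd : ∀ x y, p x → p y → p (x + y)) (v) : p v :=
  TensorProduct.induction_on v h0 ht hadd

theorem smul_rtmul (c : k) (x : M) (y : N) : rtmul k n q (c • x) y = c • rtmul k n q x y :=
  TensorProduct.smul_tmul' c x y

theorem rtmul_smul (c : k) (x : M) (y : N) : rtmul k n q x (c • y) = c • rtmul k n q x y :=
  TensorProduct.tmul_smul c x y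

theorem zero_rtmul (y : N) : rtmul k n q (0 : M) y = 0 := TensorProduct.zero_tmul M y

theorem rtmul_zero (x : M) : rtmul k n q x (0 : N) = 0 := TensorProduct.tmul_zero N x

end Pure

section Eigen

variable {k : Type u} [Field k] {n : ℕ} {q : k}
variable {N : Type*} [AddCommGroup N] [Module k N] [Module (Taft k n q)ᵐᵒᵖ N]
  [IsScalarTower k (Taft k n q)ᵐᵒᵖ N]

theorem dual_actB_pow {ξ : k} {φ : N →ₗ[k] k} (h : ∀ v, φ (actB k n q N v) = ξ * φ v) (m : ℕ)
    (v : N) : φ ((actB k n q N ^ m) v) = ξ ^ m * φ v := by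
  induction m with
  | zero => simp
  | succ m ih => rw [pow_succ', Module.End.mul_apply, h, ih, pow_succ', mul_assoc]

end Eigen

section Tensor

variable {k : Type u} [Field k] {n : ℕ} {q : k}
  [hn : Fact (2 ≤ n)] [hq : Fact (IsPrimitiveRoot q n)]
variable {M : Type*} [AddCommGroup M] [Module k M] [Module (Taft k n q)ᵐᵒᵖ M]
  [IsScalarTower k (Taft k n q)ᵐᵒᵖ M]
variable {N : Type*} [AddCommGroup N] [Module k N] [Module (Taft k n q)ᵐᵒᵖ N]
  [IsScalarTower k (Taft k n q)ᵐᵒᵖ N]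

instance : IsScalarTower k (Taft k n q)ᵐᵒᵖ (RightTensor k (Taft k n q) M N) where
  smul_assoc c x y := by
    change rightTensorAction k (Taft k n q) M N (c • x) (show M ⊗[k] N from y) =
      c • rightTensorAction k (Taft k n q) M N x (show M ⊗[k] N from y)
    rw [map_smul, LinearMap.smul_apply]

theorem comul_a : Bialgebra.comulAlgHom k (Taft k n q) (a k n q)
    = a k n q ⊗ₜ[k] b k n q + 1 ⊗ₜ[k] a k n q := by
  change comulHom k n q _ = _
  rw [comulHom, lift_a]

theorem comul_b : Bialgebra.comulAlgHom k (Taft k n q) (b k n q) = b k n q ⊗ₜ[k] b k n q := by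
  change comulHom k n q _ = _
  rw [comulHom, lift_b]

theorem actA_rtmul (x : M) (y : N) :
    actA k n q (RightTensor k (Taft k n q) M N) (rtmul k n q x y)
      = rtmul k n q (actA k n q M x) (actB k n q N y) + rtmul k n q x (actA k n q N y) := by
  change Module.endTensorEndAlgHom (R := k) (S := k) (A := k) (M := M) (N := N)
    (Algebra.TensorProduct.map (Algebra.lsmul k k M : (Taft k n q)ᵐᵒᵖ →ₐ[k] Module.End k M)
      (Algebra.lsmul k k N : (Taft k n q)ᵐᵒᵖ →ₐ[k] Module.End k N)
      ((Algebra.TensorProduct.opAlgEquiv k k (Taft k n q) (Taft k n q)).symm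
        (op (Bialgebra.comulAlgHom k (Taft k n q) (a k n q))))) (x ⊗ₜ[k] y) = _
  rw [comul_a, op_add, map_add, map_add, map_add, LinearMap.add_apply]
  simp
  rfl

theorem actB_rtmul (x : M) (y : N) :
    actB k n q (RightTensor k (Taft k n q) M N) (rtmul k n q x y)
      = rtmul k n q (actB k n q M x) (actB k n q N y) := by
  change Module.endTensorEndAlgHom (R := k) (S := k) (A := k) (M := M) (N := N)
    (Algebra.TensorProduct.map (Algebra.lsmul k k M : (Taft k n q)ᵐᵒᵖ →ₐ[k] Module.End k M)
      (Algebra.lsmul k k N : (Taft k n q)ᵐᵒᵖ →ₐ[k] Module.End k N)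
      ((Algebra.TensorProduct.opAlgEquiv k k (Taft k n q) (Taft k n q)).symm
        (op (Bialgebra.comulAlgHom k (Taft k n q) (b k n q))))) (x ⊗ₜ[k] y) = _
  rw [comul_b]
  simp
  rfl

theorem actA_pow_rtmul (m : ℕ) (x : M) (y : N) :
    (actA k n q (RightTensor k (Taft k n q) M N) ^ m) (rtmul k n q x y) =
      ∑ j ∈ Finset.range (m + 1), gauss q m j • rtmul k n q
        ((actA k n q M ^ j) x) ((actB k n q N ^ j) ((actA k n q N ^ (m - j)) y)) := by
  have h : (TensorProduct.map 1 (actA k n q N) : Module.End k (M ⊗[k] N)) *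
      TensorProduct.map (actA k n q M) (actB k n q N) =
      q • (TensorProduct.map (actA k n q M) (actB k n q N) *
        TensorProduct.map 1 (actA k n q N)) := by
    rw [← TensorProduct.map_mul, ← TensorProduct.map_mul, actA_mul_actB, one_mul, mul_one,
      TensorProduct.map_smul_right]
  have h' := add_pow_gauss _ _ h m
  have hA : (actA k n q (RightTensor k (Taft k n q) M N) : Module.End k (M ⊗[k] N)) =
      TensorProduct.map 1 (actA k n q N) + TensorProduct.map (actA k n q M) (actB k n q N) :=
    TensorProduct.ext' fun x y => (actA_rtmul x y).trans (add_comm _ _)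
  have hA' : (actA k n q (RightTensor k (Taft k n q) M N) ^ m) (rtmul k n q x y) =
      ((TensorProduct.map 1 (actA k n q N) + TensorProduct.map (actA k n q M) (actB k n q N) :
        Module.End k (M ⊗[k] N)) ^ m) (x ⊗ₜ[k] y) :=
    congrArg (fun f : Module.End k (M ⊗[k] N) => (f ^ m) (x ⊗ₜ[k] y)) hA
  rw [hA', h']
  simp only [LinearMap.sum_apply, LinearMap.smul_apply, Module.End.mul_apply, TensorProduct.map_pow,
    TensorProduct.map_tmul, one_pow, Module.End.one_apply]
  rfl

/-- The longest string of the Clebsch–Gordan decomposition: the product of two split strings with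
`r + r' < n` contains a split string whose generator is the product of the generators. -/
theorem HasString.rightTensor_top {r r' : ℕ} {ζ ζ' : k} (hr : r + r' < n)
    (hM : HasString k n q M r ζ) (hN : HasString k n q N r' ζ') :
    HasString k n q (RightTensor k (Taft k n q) M N) (r + r') (ζ * ζ') := by
  have hn0 : n ≠ 0 := by have := hn.out; omega
  have hq0 : q ≠ 0 := hq.out.ne_zero hn0
  obtain ⟨-, w, φ, hwB, hw0, hφw, hφA, hφB⟩ := hM.exists_dual hq.out hn0
  obtain ⟨hζ', w', ψ, hwB', hw0', hψw, hψA, hψB⟩ := hN.exists_dual hq.out hn0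
  refine ⟨rtmul k n q w w', ?_, ?_, fun v hv => ?_⟩
  · rw [actB_rtmul, hwB, hwB', smul_rtmul, rtmul_smul, smul_smul]
  · rw [actA_pow_rtmul]
    refine Finset.sum_eq_zero fun j _ => ?_
    rcases le_or_gt (r + 1) j with h | h
    · rw [actA_pow_eq_zero_of_le k n q h hw0, zero_rtmul, smul_zero]
    · rw [actA_pow_eq_zero_of_le k n q (m' := r + r' + 1 - j) (by omega) hw0', map_zero, rtmul_zero,
        smul_zero]
  · have hφA' : ∀ i, r < i → ∀ v, φ ((actA k n q M ^ i) v) = 0 := by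
      intro i hi v
      obtain ⟨m, rfl⟩ := Nat.exists_eq_add_of_le (Nat.succ_le_of_lt hi)
      rw [pow_add, Module.End.mul_apply, hφA]
    have hψA' : ∀ i, r' < i → ∀ v, ψ ((actA k n q N ^ i) v) = 0 := by
      intro i hi v
      obtain ⟨m, rfl⟩ := Nat.exists_eq_add_of_le (Nat.succ_le_of_lt hi)
      rw [pow_add, Module.End.mul_apply, hψA]
    have h1 : ∀ v, rtForm k n q φ ψ
        ((actA k n q (RightTensor k (Taft k n q) M N) ^ (r + r' + 1)) v) = 0 := by
      intro v
      induction v using rightTensor_induction with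
      | h0 => rw [map_zero, map_zero]
      | hadd x y hx hy => rw [map_add, map_add, hx, hy, add_zero]
      | ht x y =>
        rw [actA_pow_rtmul, map_sum]
        refine Finset.sum_eq_zero fun j _ => ?_
        rw [map_smul, rtForm_rtmul, dual_actB_pow hψB]
        rcases le_or_gt (r + 1) j with h | h
        · rw [hφA' j h, zero_mul, smul_zero]
        · rw [hψA' _ (by omega), mul_zero, mul_zero, smul_zero]
    have h2 := congrArg (rtForm k n q φ ψ) hv
    rw [h1, actA_pow_rtmul, map_sum, Finset.sum_eq_single r, map_smul, rtForm_rtmul, hφw,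
      dual_actB_pow hψB, Nat.add_sub_cancel_left, hψw, one_mul, mul_one, smul_eq_mul, eq_comm,
      mul_eq_zero] at h2
    · refine h2.elim (gauss_ne_zero hq.out hr r (by omega)) (pow_ne_zero _ (div_ne_zero ?_ ?_))
      · rintro rfl
        rw [zero_pow hn0] at hζ'
        exact zero_ne_one hζ'
      · exact pow_ne_zero _ hq0
    · intro j _ hj
      rw [map_smul, rtForm_rtmul]
      rcases Nat.lt_or_gt_of_ne hj with h | h
      · rw [actA_pow_eq_zero_of_le k n q (m' := r + r' - j) (by omega) hw0', map_zero, map_zero,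
          mul_zero, smul_zero]
      · rw [actA_pow_eq_zero_of_le k n q h hw0, map_zero, zero_mul, smul_zero]
    · intro h
      exact absurd (Finset.mem_range.2 (by omega)) h

end Tensor

end Taft

namespace Taft

/-! ### A triangular operator of order `n` on sequences -/

section Sequences

variable {k : Type u} [Field k]

/-- The right shift of sequences. -/
def seqShift (k : Type u) [Field k] : Module.End k (ℕ → k) where
  toFun c j := if j = 0 then 0 else c (j - 1)
  map_add' c c' := by ext j; by_cases h : j = 0 <;> simp [h]
  map_smul' x c := by ext j; by_cases h : j = 0 <;> simp [h]

/-- Multiplication of the `j`-th term of a sequence by `ζ q ^ (-j)`. -/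
def seqDiag (q ζ : k) : Module.End k (ℕ → k) where
  toFun c j := ζ / q ^ j * c j
  map_add' c c' := by ext j; simp [mul_add]
  map_smul' x c := by ext j; simp; ring

/-- The action of `a` on the combinations `∑ c_j x a ^ (D - j) ⊗ y a ^ j` with fixed `D`, where
`y b = ζ y`: it multiplies the `j`-th coefficient by `ζ q ^ (-j)` and adds the previous one. -/
def seqAct (q ζ : k) : Module.End k (ℕ → k) := seqShift k + seqDiag q ζ

theorem seqAct_zero (q ζ : k) (c : ℕ → k) : seqAct q ζ c 0 = ζ * c 0 := by
  simp [seqAct, seqShift, seqDiag]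

theorem seqAct_succ (q ζ : k) (c : ℕ → k) (j : ℕ) :
    seqAct q ζ c (j + 1) = c j + ζ / q ^ (j + 1) * c (j + 1) := by
  simp [seqAct, seqShift, seqDiag]

theorem seqShift_pow (m : ℕ) (c : ℕ → k) (j : ℕ) :
    (seqShift k ^ m) c j = if j < m then 0 else c (j - m) := by
  induction m generalizing c j with
  | zero => simp
  | succ m ih =>
    rw [pow_succ, Module.End.mul_apply, ih]
    simp only [seqShift, LinearMap.coe_mk, AddHom.coe_mk]
    split_ifs
    · rfl
    · omega
    · rfl
    · omega
    · omega
    · congr 1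

theorem seqDiag_pow (q ζ : k) (m : ℕ) (c : ℕ → k) (j : ℕ) :
    (seqDiag q ζ ^ m) c j = (ζ / q ^ j) ^ m * c j := by
  induction m generalizing c j with
  | zero => simp
  | succ m ih =>
    rw [pow_succ, Module.End.mul_apply, ih]
    simp only [seqDiag, LinearMap.coe_mk, AddHom.coe_mk]
    ring

theorem seqAct_pow {q : k} (hq : q ≠ 0) (ζ : k) (m : ℕ) (c : ℕ → k) (j : ℕ) :
    (seqAct q ζ ^ m) c j = ∑ i ∈ Finset.range (m + 1),
      gauss q m i * ((ζ / q ^ j) ^ i * if j < m - i then 0 else c (j - (m - i))) := by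
  have h : seqShift k * seqDiag q ζ = q • (seqDiag q ζ * seqShift k) := by
    ext1 c
    funext j
    cases j with
    | zero => simp [seqShift, seqDiag]
    | succ j =>
      simp [seqShift, seqDiag]
      field_simp
      ring
  rw [seqAct, add_pow_gauss _ _ h]
  simp only [LinearMap.sum_apply, Finset.sum_apply, LinearMap.smul_apply, Pi.smul_apply,
    Module.End.mul_apply, seqDiag_pow, seqShift_pow, smul_eq_mul]

/-- On the first `n` terms the operator has order `n`, by the `q`-binomial theorem. -/
theorem seqAct_pow_order {n : ℕ} {q ζ : k} (hn : n ≠ 0) (hq : IsPrimitiveRoot q n)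
    (hζ : ζ ^ n = 1) (c : ℕ → k) {j : ℕ} (hj : j < n) : (seqAct q ζ ^ n) c j = c j := by
  rw [seqAct_pow (hq.ne_zero hn), Finset.sum_range_succ, Finset.sum_eq_zero, zero_add, gauss_self,
    Nat.sub_self, if_neg (by omega), Nat.sub_zero, div_pow, hζ, ← pow_mul, mul_comm j, pow_mul,
    hq.pow_eq_one, one_pow, div_one, one_mul, one_mul]
  intro i hi
  have hi := Finset.mem_range.1 hi
  rcases i with _ | i
  · rw [if_pos (by omega), mul_zero, mul_zero]
  · rw [gauss_vanish hq hn i hi, zero_mul]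

theorem seqAct_pow_congr (q ζ : k) {s : ℕ} {c c' : ℕ → k} (h : ∀ j ≤ s, c j = c' j) (m : ℕ) :
    ∀ j ≤ s, (seqAct q ζ ^ m) c j = (seqAct q ζ ^ m) c' j := by
  induction m with
  | zero => exact h
  | succ m ih =>
    intro j hj
    rw [pow_succ', Module.End.mul_apply, Module.End.mul_apply]
    cases j with
    | zero => rw [seqAct_zero, seqAct_zero, ih 0 hj]
    | succ j => rw [seqAct_succ, seqAct_succ, ih _ hj, ih j (by omega)]

theorem seqAct_pow_single_ne_zero {n : ℕ} {q ζ : k} (hn : n ≠ 0) (hq : IsPrimitiveRoot q n)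
    (hζ : ζ ^ n = 1) {m s : ℕ} (hs : s ≤ m) (hm : m < n) :
    (seqAct q ζ ^ m) (Pi.single 0 1) s ≠ 0 := by
  have hq0 := hq.ne_zero hn
  have hζ0 : ζ ≠ 0 := by
    rintro rfl
    rw [zero_pow hn] at hζ
    exact zero_ne_one hζ
  rw [seqAct_pow hq0, Finset.sum_eq_single (m - s)]
  · rw [Nat.sub_sub_self hs, if_neg (lt_irrefl s), Nat.sub_self, Pi.single_eq_same, mul_one]
    exact mul_ne_zero (gauss_ne_zero hq hm _ (Nat.sub_le m s))
      (pow_ne_zero _ (div_ne_zero hζ0 (pow_ne_zero _ hq0)))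
  · intro i hi hne
    have hi := Finset.mem_range.1 hi
    split_ifs with h
    · rw [mul_zero, mul_zero]
    · rw [Pi.single_eq_of_ne (by omega), mul_zero, mul_zero]
  · intro h
    exact absurd (Finset.mem_range.2 (by omega)) h

end Sequences

/-! ### The shortest string of a tensor product -/

section Tensor

variable {k : Type u} [Field k] {n : ℕ} {q : k}
  [hn : Fact (2 ≤ n)] [hq : Fact (IsPrimitiveRoot q n)]
variable {M : Type*} [AddCommGroup M] [Module k M] [Module (Taft k n q)ᵐᵒᵖ M]
  [IsScalarTower k (Taft k n q)ᵐᵒᵖ M]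
variable {N : Type*} [AddCommGroup N] [Module k N] [Module (Taft k n q)ᵐᵒᵖ N]
  [IsScalarTower k (Taft k n q)ᵐᵒᵖ N]

/-- The shortest string of the Clebsch–Gordan decomposition. On the combinations
`∑_{j ≤ s} c_j w a ^ (D - j) ⊗ w' a ^ j` of degree `D ≥ s` the action of `a` is given by `seqAct`,
which does not depend on `D` and is invertible; the generator of the string is the combination of
degree `s` that `a ^ (r + 1)` sends to `w a ^ (r + s + 1) ⊗ w' = 0`. -/
theorem HasString.rightTensor_bot {r s : ℕ} {ζ ζ' : k} (hr : r + s + 2 ≤ n)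
    (hM : HasString k n q M (r + s) ζ) (hN : HasString k n q N s ζ') :
    HasString k n q (RightTensor k (Taft k n q) M N) r (ζ * ζ' / q ^ s) := by
  have hn0 : n ≠ 0 := by have := hn.out; omega
  have hq0 : q ≠ 0 := hq.out.ne_zero hn0
  obtain ⟨-, w, φ, hwB, hw0, hφw, hφA, -⟩ := hM.exists_dual hq.out hn0
  obtain ⟨hζ', w', ψ, hwB', hw0', hψw, hψA, hψB⟩ := hN.exists_dual hq.out hn0
  let L := seqAct q ζ'
  -- The vector of degree `D` with coefficients `c`, and the action of `a` on it.
  let θ : ℕ → (ℕ → k) → RightTensor k (Taft k n q) M N := fun D c =>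
    ∑ j ∈ Finset.range (s + 1), c j •
      rtmul k n q ((actA k n q M ^ (D - j)) w) ((actA k n q N ^ j) w')
  have hθ1 : ∀ D, s ≤ D → ∀ c, actA k n q _ (θ D c) = θ (D + 1) (L c) := by
    intro D hD c
    have e1 : actA k n q _ (θ D c) = ∑ j ∈ Finset.range (s + 1), ((ζ' / q ^ j * c j) •
          rtmul k n q ((actA k n q M ^ (D + 1 - j)) w) ((actA k n q N ^ j) w')) +
        ∑ j ∈ Finset.range (s + 1), (c j •
          rtmul k n q ((actA k n q M ^ (D - j)) w) ((actA k n q N ^ (j + 1)) w')) := by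
      simp only [θ]
      rw [map_sum, ← Finset.sum_add_distrib]
      refine Finset.sum_congr rfl fun j hj => ?_
      have hj := Finset.mem_range.1 hj
      rw [map_smul, actA_rtmul, smul_add, actB_actA_pow k n q hq0 hwB', rtmul_smul, smul_smul,
        ← Module.End.mul_apply, ← pow_succ', ← Module.End.mul_apply, ← pow_succ', mul_comm (c j),
        Nat.sub_add_comm (by omega)]
    have e2 : ∑ j ∈ Finset.range (s + 1), (c j •
          rtmul k n q ((actA k n q M ^ (D - j)) w) ((actA k n q N ^ (j + 1)) w')) =
        ∑ j ∈ Finset.range s, (c j •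
          rtmul k n q ((actA k n q M ^ (D + 1 - (j + 1))) w) ((actA k n q N ^ (j + 1)) w')) := by
      rw [Finset.sum_range_succ, hw0', rtmul_zero, smul_zero, add_zero]
      simp only [Nat.add_sub_add_right]
    rw [e1, e2, Finset.sum_range_succ']
    simp only [θ]
    rw [Finset.sum_range_succ' _ s, add_right_comm, ← Finset.sum_add_distrib]
    congr 1
    · refine Finset.sum_congr rfl fun j _ => ?_
      rw [← add_smul, seqAct_succ, add_comm]
    · rw [seqAct_zero, pow_zero, div_one]
  have hθ : ∀ m D, s ≤ D → ∀ c, (actA k n q _ ^ m) (θ D c) = θ (D + m) ((L ^ m) c) := by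
    intro m
    induction m with
    | zero => intro D _ c; rfl
    | succ m ih =>
      intro D hD c
      rw [pow_succ, Module.End.mul_apply, hθ1 D hD, ih (D + 1) (by omega), pow_succ,
        Module.End.mul_apply, add_assoc, add_comm 1 m]
  -- The coordinates of a vector in degree `r + s - E`, read off by the linear forms.
  let C : ℕ → RightTensor k (Taft k n q) M N → ℕ → k := fun E v j =>
    rtForm k n q (φ ∘ₗ (actA k n q M ^ (E + j))) (ψ ∘ₗ (actA k n q N ^ (s - j))) v
  have hC1 : ∀ E v, ∀ j ≤ s, C E (actA k n q _ v) j = L (C (E + 1) v) j := by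
    intro E v j hj
    have hdiag : ψ ∘ₗ (actA k n q N ^ (s - j)) ∘ₗ actB k n q N
        = (ζ' / q ^ j) • (ψ ∘ₗ (actA k n q N ^ (s - j))) := by
      ext y
      simp only [LinearMap.comp_apply, LinearMap.smul_apply, smul_eq_mul]
      rw [actA_pow_actB, map_smul, hψB, smul_eq_mul, ← mul_assoc]
      congr 1
      obtain ⟨t, rfl⟩ := Nat.exists_eq_add_of_le hj
      rw [Nat.add_sub_cancel_left, pow_add]
      field_simp
    induction v using rightTensor_induction with
    | h0 =>
      have h1 : C (E + 1) 0 = 0 := by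
        funext j
        exact map_zero _
      rw [h1, map_zero, map_zero]
      exact map_zero _
    | hadd x y hx hy =>
      have h1 : C (E + 1) (x + y) = C (E + 1) x + C (E + 1) y := by
        funext j
        exact map_add _ _ _
      rw [h1, map_add, map_add, Pi.add_apply, ← hx, ← hy]
      exact map_add _ _ _
    | ht x y =>
      have h2 := LinearMap.congr_fun hdiag y
      simp only [LinearMap.comp_apply, LinearMap.smul_apply, smul_eq_mul] at h2
      have h3 : C E (actA k n q _ (rtmul k n q x y)) j =
          ζ' / q ^ j * (φ ((actA k n q M ^ (E + 1 + j)) x) * ψ ((actA k n q N ^ (s - j)) y)) +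
          φ ((actA k n q M ^ (E + j)) x) * ψ ((actA k n q N ^ (s - j + 1)) y) := by
        simp only [C]
        rw [actA_rtmul, map_add, rtForm_rtmul, rtForm_rtmul]
        simp only [LinearMap.comp_apply]
        rw [h2, ← Module.End.mul_apply, ← pow_succ, ← Module.End.mul_apply, ← pow_succ,
          add_right_comm E j 1]
        ring
      rw [h3]
      cases j with
      | zero =>
        rw [seqAct_zero, Nat.sub_zero, hψA, mul_zero, add_zero, pow_zero, div_one]
        simp only [C]
        rw [rtForm_rtmul]
        rfl
      | succ j =>
        rw [seqAct_succ, add_comm]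
        simp only [C]
        rw [rtForm_rtmul, rtForm_rtmul]
        simp only [LinearMap.comp_apply]
        rw [show s - (j + 1) + 1 = s - j by omega, show E + (j + 1) = E + 1 + j by omega]
  have hC : ∀ m E v, ∀ j ≤ s, C E ((actA k n q _ ^ m) v) j = (L ^ m) (C (E + m) v) j := by
    intro m
    induction m with
    | zero => intro E v j _; rfl
    | succ m ih =>
      intro E v j hj
      rw [pow_succ, Module.End.mul_apply, ih E _ j hj,
        seqAct_pow_congr q ζ' (hC1 (E + m) v) m j hj, pow_succ, Module.End.mul_apply]
      rfl
  have hφA' : ∀ i, r + s < i → ∀ v, φ ((actA k n q M ^ i) v) = 0 := by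
    intro i hi v
    obtain ⟨m, rfl⟩ := Nat.exists_eq_add_of_le (Nat.succ_le_of_lt hi)
    rw [pow_add, Module.End.mul_apply, hφA]
  have hCθ : ∀ c, ∀ j ≤ s, C 0 (θ (s + r) c) j = c j := by
    intro c j hj
    simp only [C, θ]
    rw [map_sum, Finset.sum_eq_single j]
    · rw [map_smul, rtForm_rtmul, LinearMap.comp_apply, LinearMap.comp_apply,
        ← Module.End.mul_apply, ← Module.End.mul_apply, ← pow_add, ← pow_add,
        show 0 + j + (s + r - j) = r + s by omega, show s - j + j = s by omega, hφw, hψw]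
      simp
    · intro i hi hne
      have hi := Finset.mem_range.1 hi
      rw [map_smul, rtForm_rtmul, LinearMap.comp_apply, LinearMap.comp_apply,
        ← Module.End.mul_apply, ← Module.End.mul_apply, ← pow_add, ← pow_add]
      rcases Nat.lt_or_gt_of_ne hne with h | h
      · rw [hφA' _ (by omega), zero_mul, smul_zero]
      · rw [actA_pow_eq_zero_of_le k n q (m' := s - j + i) (by omega) hw0', map_zero, mul_zero,
          smul_zero]
    · intro h
      exact absurd (Finset.mem_range.2 (by omega)) h
  have hLn : ∀ c, ∀ j ≤ s, (L ^ n) c j = c j := fun c j hj =>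
    seqAct_pow_order hn0 hq.out hζ' c (by omega)
  let δ : ℕ → k := Pi.single 0 1
  refine ⟨θ s ((L ^ (n - (r + 1))) δ), ?_, ?_, fun v hv => ?_⟩
  · simp only [θ]
    rw [map_sum, Finset.smul_sum]
    refine Finset.sum_congr rfl fun j hj => ?_
    have hj := Finset.mem_range.1 hj
    rw [map_smul, actB_rtmul, actB_actA_pow k n q hq0 hwB, actB_actA_pow k n q hq0 hwB', smul_rtmul,
      rtmul_smul, smul_smul, smul_smul, smul_smul]
    congr 1
    rw [← Nat.sub_add_cancel (Nat.le_of_lt_succ hj), Nat.add_sub_cancel, pow_add]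
    field_simp
  · rw [hθ _ _ le_rfl, ← Module.End.mul_apply, ← pow_add, Nat.add_sub_cancel' (by omega)]
    simp only [θ]
    refine Finset.sum_eq_zero fun j hj => ?_
    have hj := Finset.mem_range.1 hj
    rw [hLn _ j (by omega)]
    rcases Nat.eq_zero_or_pos j with rfl | hj0
    · rw [actA_pow_eq_zero_of_le k n q (m' := s + (r + 1) - 0) (by omega) hw0, zero_rtmul,
        smul_zero]
    · simp only [δ]
      rw [Pi.single_eq_of_ne (by omega), zero_smul]
  · have h1 : ∀ j ≤ s, (L ^ (r + 1)) (C (r + 1) v) j = (L ^ (n - 1)) δ j := by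
      intro j hj
      have h2 := hC (r + 1) 0 v j hj
      rw [hv, hθ _ _ le_rfl, hCθ _ j hj, ← Module.End.mul_apply, ← pow_add,
        show r + (n - (r + 1)) = n - 1 by omega, Nat.zero_add] at h2
      exact h2.symm
    have h2 := seqAct_pow_congr q ζ' h1 (n - (r + 1)) s le_rfl
    change (L ^ _) _ s = (L ^ _) _ s at h2
    rw [← Module.End.mul_apply, ← Module.End.mul_apply, ← pow_add, ← pow_add,
      Nat.sub_add_cancel (by omega), hLn _ s le_rfl,
      show n - (r + 1) + (n - 1) = n + (n - (r + 2)) by omega, pow_add, Module.End.mul_apply,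
      hLn _ s le_rfl] at h2
    refine seqAct_pow_single_ne_zero hn0 hq.out hζ' (m := n - (r + 2)) (s := s) (by omega)
      (by omega) (h2.symm.trans ?_)
    -- The coordinate `s` in degree `s - 1` is zero.
    change rtForm k n q _ _ v = 0
    have h3 : φ ∘ₗ (actA k n q M ^ (r + 1 + s)) = 0 := by
      ext x
      exact hφA' _ (by omega) x
    rw [h3]
    rw [rtForm_zero_left, LinearMap.zero_apply]

end Tensor

end Taft

namespace QuantumDouble

/-! ### Commutation rules in the quantum double -/

section Relations

variable (k : Type u) [Field k] (n : ℕ) (q : k)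

theorem d_pow : gen k n q .d ^ n = 0 := by
  have h := RingQuot.mkAlgHom_rel k (DoubleRel.d_pow (k := k) (n := n) (q := q))
  rw [map_pow, map_zero] at h
  exact h

theorem c_pow : gen k n q .c ^ n = 1 := by
  have h := RingQuot.mkAlgHom_rel k (DoubleRel.c_pow (k := k) (n := n) (q := q))
  rw [map_pow, map_one] at h
  exact h

theorem d_mul_c : gen k n q .d * gen k n q .c = q • (gen k n q .c * gen k n q .d) := by
  have h := RingQuot.mkAlgHom_rel k (DoubleRel.d_mul_c (k := k) (n := n) (q := q))
  rw [map_mul, map_smul, map_mul] at h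
  exact h

theorem d_mul_b : gen k n q .d * gen k n q .b = q • (gen k n q .b * gen k n q .d) := by
  have h := RingQuot.mkAlgHom_rel k (DoubleRel.d_mul_b (k := k) (n := n) (q := q))
  rw [map_mul, map_smul, map_mul] at h
  exact h

theorem b_mul_c : gen k n q .b * gen k n q .c = gen k n q .c * gen k n q .b := by
  have h := RingQuot.mkAlgHom_rel k (DoubleRel.b_mul_c (k := k) (n := n) (q := q))
  rw [map_mul, map_mul] at h
  exact h

theorem c_mul_a : gen k n q .c * gen k n q .a = q • (gen k n q .a * gen k n q .c) := by
  have h := RingQuot.mkAlgHom_rel k (DoubleRel.c_mul_a (k := k) (n := n) (q := q))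
  rw [map_mul, map_smul, map_mul] at h
  exact h

theorem d_mul_a : gen k n q .d * gen k n q .a =
    q • (gen k n q .a * gen k n q .d) + (1 - gen k n q .b * gen k n q .c) := by
  have h := RingQuot.mkAlgHom_rel k (DoubleRel.d_mul_a (k := k) (n := n) (q := q))
  rw [map_sub, map_mul, map_smul, map_mul, map_sub, map_mul, map_one, sub_eq_iff_eq_add'] at h
  exact h

variable {k n q}

/-- The quantum double is generated by `a`, `b`, `c`, `d`. -/
theorem induction {p : QuantumDouble k n q → Prop} (hk : ∀ c : k, p (algebraMap k _ c))
    (hg : ∀ g, p (gen k n q g)) (hadd : ∀ x y, p x → p y → p (x + y))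
    (hmul : ∀ x y, p x → p y → p (x * y)) (x : QuantumDouble k n q) : p x := by
  obtain ⟨z, rfl⟩ := RingQuot.mkAlgHom_surjective k (DoubleRel k n q) x
  induction z using FreeAlgebra.induction with
  | grade0 r =>
    rw [AlgHom.commutes]
    exact hk r
  | grade1 g => exact hg g
  | mul x y hx hy =>
    rw [map_mul]
    exact hmul _ _ hx hy
  | add x y hx hy =>
    rw [map_add]
    exact hadd _ _ hx hy

/-- The `q`-integer `(m)_q = 1 + q + ⋯ + q ^ (m - 1)`. -/
def qint (q : k) (m : ℕ) : k := ∑ i ∈ Finset.range m, q ^ i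

theorem qint_succ (q : k) (m : ℕ) : qint q (m + 1) = qint q m + q ^ m :=
  Finset.sum_range_succ _ _

theorem qint_succ' (q : k) (m : ℕ) : qint q (m + 1) = q * qint q m + 1 := by
  unfold qint
  rw [Finset.sum_range_succ', Finset.mul_sum]
  simp only [pow_succ', pow_zero]

theorem qint_ne_zero (hq : IsPrimitiveRoot q n) {m : ℕ} (h0 : m ≠ 0) (hm : m < n) :
    qint q m ≠ 0 := by
  intro h
  have h1 := geom_sum_mul q m
  rw [qint] at h
  rw [h, zero_mul, eq_comm, sub_eq_zero] at h1
  exact hq.pow_ne_one_of_pos_of_lt h0 hm h1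

theorem qint_order (hq : IsPrimitiveRoot q n) (hn : 2 ≤ n) : qint q n = 0 :=
  hq.geom_sum_eq_zero hn

theorem d_pow_mul_b (j : ℕ) :
    gen k n q .d ^ j * gen k n q .b = q ^ j • (gen k n q .b * gen k n q .d ^ j) := by
  induction j with
  | zero => simp
  | succ j ih =>
    rw [pow_succ', mul_assoc, ih, mul_smul_comm, ← mul_assoc, d_mul_b, smul_mul_assoc, smul_smul,
      mul_assoc, pow_succ]

theorem d_pow_mul_c (j : ℕ) :
    gen k n q .d ^ j * gen k n q .c = q ^ j • (gen k n q .c * gen k n q .d ^ j) := by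
  induction j with
  | zero => simp
  | succ j ih =>
    rw [pow_succ', mul_assoc, ih, mul_smul_comm, ← mul_assoc, d_mul_c, smul_mul_assoc, smul_smul,
      mul_assoc, pow_succ]

theorem c_pow_mul_a (j : ℕ) :
    gen k n q .c ^ j * gen k n q .a = q ^ j • (gen k n q .a * gen k n q .c ^ j) := by
  induction j with
  | zero => simp
  | succ j ih =>
    rw [pow_succ', mul_assoc, ih, mul_smul_comm, ← mul_assoc, c_mul_a, smul_mul_assoc, smul_smul,
      mul_assoc, pow_succ]

theorem d_pow_mul_a (j : ℕ) :
    gen k n q .d ^ (j + 1) * gen k n q .a = q ^ (j + 1) • (gen k n q .a * gen k n q .d ^ (j + 1)) +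
      qint q (j + 1) • (gen k n q .d ^ j -
        q ^ j • (gen k n q .b * gen k n q .c * gen k n q .d ^ j)) := by
  induction j with
  | zero => simp [d_mul_a, qint]
  | succ j ih =>
    rw [pow_succ' _ (j + 1), mul_assoc, ih, mul_add, mul_smul_comm, mul_smul_comm, mul_sub,
      mul_smul_comm]
    set A := gen k n q .a
    set B := gen k n q .b
    set C := gen k n q .c
    set E := gen k n q .d
    have h1 : E * (A * E ^ (j + 1)) = q • (A * E ^ (j + 1 + 1)) + (E ^ (j + 1) -
        B * C * E ^ (j + 1)) := by
      rw [← mul_assoc, d_mul_a, add_mul, smul_mul_assoc, mul_assoc, ← pow_succ', sub_mul, one_mul]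
    have h2 : E * (B * C * E ^ j) = (q * q) • (B * C * E ^ (j + 1)) := by
      rw [← mul_assoc, ← mul_assoc, d_mul_b, smul_mul_assoc, smul_mul_assoc, mul_assoc B E C,
        d_mul_c, mul_smul_comm, smul_mul_assoc, smul_smul, pow_succ', mul_assoc, mul_assoc,
        mul_assoc]
    rw [h1, h2, ← pow_succ', qint_succ' q (j + 1)]
    have h3 : qint q (j + 1) = qint q j + q ^ j := qint_succ q j
    have h4 : qint q (j + 1) = q * qint q j + 1 := qint_succ' q j
    have h5 : q * qint q (j + 1) + 1 = qint q (j + 1) + q ^ (j + 1) := by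
      rw [← qint_succ', qint_succ]
    have h6 : q ^ (j + 1) + qint q (j + 1) * q ^ j * (q * q) =
        (q * qint q (j + 1) + 1) * q ^ (j + 1) := by ring
    rw [smul_add, smul_sub, smul_sub, smul_sub, smul_smul, smul_smul, smul_smul, smul_smul, ← h6,
      h5, add_smul, add_smul, ← pow_succ, ← pow_succ']
    abel

end Relations

/-! ### The module `Q` -/

section Quotient

variable (k : Type u) [Field k] (n : ℕ) (q : k)
  [hn : Fact (2 ≤ n)] [hq : Fact (IsPrimitiveRoot q n)]

/-- The quotient map `D → Q`. -/
noncomputable def mk : QuantumDouble k n q →ₗ[k] Q k n q :=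
  ((augmentationRightIdeal k n q).mkQ.restrictScalars k :
    QuantumDouble k n q →ₗ[k] (QuantumDouble k n q ⧸ augmentationRightIdeal k n q))

variable {k n q}

theorem mk_surjective : Function.Surjective (mk k n q) :=
  (augmentationRightIdeal k n q).mkQ_surjective

theorem mk_eq_zero_iff {x : QuantumDouble k n q} :
    mk k n q x = 0 ↔ x ∈ augmentationRightIdeal k n q :=
  Submodule.Quotient.mk_eq_zero _

theorem mk_augmentation_mul {r : Taft k n q} (hr : Coalgebra.counit (R := k) r = 0)
    (y : QuantumDouble k n q) : mk k n q (ofTaft k n q r * y) = 0 :=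
  mk_eq_zero_iff.2 ((augmentationRightIdeal k n q).smul_mem (op y)
    (Submodule.subset_span ⟨r, hr, rfl⟩))

theorem counit_a : Coalgebra.counit (R := k) (Taft.a k n q) = 0 := by
  change Taft.counitHom k n q _ = _
  rw [Taft.counitHom, Taft.lift_a]

theorem counit_b : Coalgebra.counit (R := k) (Taft.b k n q) = 1 := by
  change Taft.counitHom k n q _ = _
  rw [Taft.counitHom, Taft.lift_b]

omit hn hq in
theorem ofTaft_a : ofTaft k n q (Taft.a k n q) = gen k n q .a := by
  rw [ofTaft, Taft.lift_a]

omit hn hq in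
theorem ofTaft_b : ofTaft k n q (Taft.b k n q) = gen k n q .b := by
  rw [ofTaft, Taft.lift_b]

theorem mk_a_mul (y : QuantumDouble k n q) : mk k n q (gen k n q .a * y) = 0 := by
  rw [← ofTaft_a]
  exact mk_augmentation_mul counit_a y

theorem mk_b_mul (y : QuantumDouble k n q) : mk k n q (gen k n q .b * y) = mk k n q y := by
  rw [← sub_eq_zero, ← map_sub, ← ofTaft_b]
  have h := mk_augmentation_mul (k := k) (n := n) (q := q) (r := Taft.b k n q - 1)
    (by rw [map_sub, counit_b, Bialgebra.counit_one, sub_self]) y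
  rwa [map_sub, map_one, sub_mul, one_mul] at h

theorem actA_mk (x : QuantumDouble k n q) :
    Taft.actA k n q (Q k n q) (mk k n q x) = mk k n q (x * gen k n q .a) := by
  rw [← ofTaft_a]
  rfl

theorem actB_mk (x : QuantumDouble k n q) :
    Taft.actB k n q (Q k n q) (mk k n q x) = mk k n q (x * gen k n q .b) := by
  rw [← ofTaft_b]
  rfl

theorem actA_pow_mk (m : ℕ) (x : QuantumDouble k n q) :
    (Taft.actA k n q (Q k n q) ^ m) (mk k n q x) = mk k n q (x * gen k n q .a ^ m) := by
  induction m generalizing x with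
  | zero => simp
  | succ m ih => rw [pow_succ, Module.End.mul_apply, actA_mk, ih, pow_succ', mul_assoc]

/-- Here `f` stands for a polynomial in `c`. -/
theorem mk_mul_d_pow_mul_b {f : QuantumDouble k n q} (hb : f * gen k n q .b = gen k n q .b * f)
    (j : ℕ) : mk k n q (f * gen k n q .d ^ j * gen k n q .b)
      = q ^ j • mk k n q (f * gen k n q .d ^ j) := by
  rw [mul_assoc, d_pow_mul_b, mul_smul_comm, ← mul_assoc, hb, mul_assoc, map_smul, mk_b_mul]

theorem mk_mul_d_pow_mul_a {f f' : QuantumDouble k n q} (hb : f * gen k n q .b = gen k n q .b * f)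
    (ha : f * gen k n q .a = gen k n q .a * f') (j : ℕ) :
    mk k n q (f * gen k n q .d ^ (j + 1) * gen k n q .a)
      = qint q (j + 1) • (mk k n q (f * gen k n q .d ^ j) -
        q ^ j • mk k n q (f * gen k n q .c * gen k n q .d ^ j)) := by
  rw [mul_assoc, d_pow_mul_a, mul_add, mul_smul_comm, ← mul_assoc f, ha, mul_assoc, map_add,
    map_smul, mk_a_mul, smul_zero, zero_add, mul_smul_comm, mul_sub, mul_smul_comm, map_smul,
    map_sub, map_smul, ← mul_assoc f, ← mul_assoc f, hb, mul_assoc (gen k n q .b),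
    mul_assoc (gen k n q .b), mk_b_mul]

/-- `Q` is spanned by the classes of the monomials `c ^ i d ^ j`. -/
theorem finite_Q : Module.Finite k (Q k n q) := by
  let v : ℕ → ℕ → Q k n q := fun i j => mk k n q (gen k n q .c ^ i * gen k n q .d ^ j)
  let S : Submodule k (Q k n q) := Submodule.span k (Set.range fun p : ℕ × ℕ => v p.1 p.2)
  have hv : ∀ i j, v i j ∈ S := fun i j => Submodule.subset_span ⟨(i, j), rfl⟩
  have hcb : ∀ i, gen k n q .c ^ i * gen k n q .b = gen k n q .b * gen k n q .c ^ i := fun i =>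
    (Commute.pow_left (b_mul_c k n q).symm i : Commute _ _)
  have hmul : ∀ y x : QuantumDouble k n q, mk k n q x ∈ S → mk k n q (x * y) ∈ S := by
    intro y
    induction y using QuantumDouble.induction with
    | hk c =>
      intro x hx
      rw [← Algebra.commutes, ← Algebra.smul_def, map_smul]
      exact S.smul_mem c hx
    | hadd y z hy hz =>
      intro x hx
      rw [mul_add, map_add]
      exact S.add_mem (hy x hx) (hz x hx)
    | hmul y z hy hz =>
      intro x hx
      rw [← mul_assoc]
      exact hz _ (hy x hx)
    | hg g =>
      have hgen : ∀ i j, mk k n q (gen k n q .c ^ i * gen k n q .d ^ j * gen k n q g) ∈ S := by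
        intro i j
        cases g with
        | a =>
          cases j with
          | zero =>
            rw [pow_zero, mul_one, c_pow_mul_a, map_smul, mk_a_mul, smul_zero]
            exact S.zero_mem
          | succ j =>
            rw [mk_mul_d_pow_mul_a (f' := q ^ i • gen k n q .c ^ i) (hcb i)
              (by rw [c_pow_mul_a, mul_smul_comm]), ← pow_succ]
            exact S.smul_mem _ (S.sub_mem (hv i j) (S.smul_mem _ (hv (i + 1) j)))
        | b =>
          rw [mk_mul_d_pow_mul_b (hcb i)]
          exact S.smul_mem _ (hv i j)
        | c =>
          rw [mul_assoc, d_pow_mul_c, mul_smul_comm, ← mul_assoc, ← pow_succ, map_smul]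
          exact S.smul_mem _ (hv (i + 1) j)
        | d =>
          rw [mul_assoc, ← pow_succ]
          exact hv i (j + 1)
      intro x hx
      let R : Module.End k (QuantumDouble k n q ⧸ augmentationRightIdeal k n q) :=
        Algebra.lsmul k k _ (op (gen k n q g))
      have hS : S ≤ S.comap (R : Q k n q →ₗ[k] Q k n q) := by
        refine Submodule.span_le.2 ?_
        rintro _ ⟨⟨i, j⟩, rfl⟩
        exact hgen i j
      exact hS hx
  have htop : S = ⊤ := by
    refine eq_top_iff.2 fun z _ => ?_
    obtain ⟨x, rfl⟩ := mk_surjective z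
    rw [← one_mul x]
    refine hmul x 1 ?_
    have h := hv 0 0
    simp only [v, pow_zero, mul_one] at h
    exact h
  refine ⟨htop ▸ (Submodule.fg_span (Set.Finite.subset
    (((Finset.range n ×ˢ Finset.range (n + 1)).finite_toSet).image fun p : ℕ × ℕ => v p.1 p.2) ?_) :
    S.FG)⟩
  rintro _ ⟨⟨i, j⟩, rfl⟩
  have hn0 : 0 < n := by have := hn.out; omega
  have hc : gen k n q .c ^ (i % n) = gen k n q .c ^ i := by
    conv_rhs => rw [← Nat.mod_add_div i n, pow_add, pow_mul, c_pow, one_pow, mul_one]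
  have hd : gen k n q .d ^ (min j n) = gen k n q .d ^ j := by
    rcases le_total j n with h | h
    · rw [min_eq_left h]
    · rw [min_eq_right h, ← Nat.sub_add_cancel h, pow_add, d_pow, mul_zero]
  refine ⟨(i % n, min j n), ?_, ?_⟩
  · simp [Nat.mod_lt _ hn0]
  · simp only [v]
    rw [hc, hd]

end Quotient

end QuantumDouble

namespace QuantumDouble

/-! ### An `n`-dimensional module of the quantum double -/

section Representation

variable {k : Type u} [Field k]

/-- The standard basis of `k ^ n`, continued by zero. -/
def repVec (k : Type u) [Field k] (n j : ℕ) : Fin n → k :=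
  if h : j < n then Pi.single ⟨j, h⟩ 1 else 0

theorem repVec_of_le {n j : ℕ} (h : n ≤ j) : repVec k n j = 0 := dif_neg (not_lt.2 h)

theorem repVec_apply {n j : ℕ} (i : Fin n) : repVec k n j i = if j = i then 1 else 0 := by
  unfold repVec
  split_ifs with h1 h2 h2
  · subst h2
    simp
  · rw [Pi.single_eq_of_ne]
    rintro rfl
    exact h2 rfl
  · omega
  · rfl

theorem repVec_hom_ext {n : ℕ} {Y : Type*} [AddCommGroup Y] [Module k Y]
    {f g : (Fin n → k) →ₗ[k] Y} (h : ∀ j < n, f (repVec k n j) = g (repVec k n j)) : f = g := by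
  refine LinearMap.pi_ext' fun i => LinearMap.ext_ring ?_
  have := h i i.2
  rw [repVec, dif_pos i.2] at this
  exact this

/-- The operator with prescribed values on the standard basis. -/
def repOp (n : ℕ) (g : ℕ → Fin n → k) : Module.End k (Fin n → k) :=
  Fintype.linearCombination k fun j : Fin n => g j

theorem repOp_repVec {n : ℕ} {g : ℕ → Fin n → k} (hg : ∀ j, n ≤ j → g j = 0) (j : ℕ) :
    repOp n g (repVec k n j) = g j := by
  unfold repVec
  split_ifs with h
  · rw [repOp, Fintype.linearCombination_apply_single, one_smul]
  · rw [map_zero, hg j (not_lt.1 h)]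

variable (n : ℕ) (q τ : k)

/-- The coefficient of the action `u_(j + 1) a = (j + 1)_q (1 - q ^ j τ) u_j`. -/
def repCoeff (j : ℕ) : k := qint q (j + 1) * (1 - q ^ j * τ)

/-- The action of `a`. -/
def repA : Module.End k (Fin n → k) :=
  repOp n fun j => if j = 0 ∨ n ≤ j then 0 else repCoeff q τ (j - 1) • repVec k n (j - 1)

/-- The action of `b`. -/
def repB : Module.End k (Fin n → k) := repOp n fun j => q ^ j • repVec k n j

/-- The action of `c`. -/
def repC : Module.End k (Fin n → k) := repOp n fun j => (q ^ j * τ) • repVec k n j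

/-- The action of `d`. -/
def repD : Module.End k (Fin n → k) := repOp n fun j => repVec k n (j + 1)

theorem repA_zero : repA n q τ (repVec k n 0) = 0 := by
  unfold repA
  rw [repOp_repVec (fun j hj => if_pos (Or.inr hj)), if_pos (Or.inl rfl)]

theorem repB_repVec (j : ℕ) : repB n q (repVec k n j) = q ^ j • repVec k n j :=
  repOp_repVec (fun j hj => by rw [repVec_of_le hj, smul_zero]) j

theorem repC_repVec (j : ℕ) : repC n q τ (repVec k n j) = (q ^ j * τ) • repVec k n j :=
  repOp_repVec (fun j hj => by rw [repVec_of_le hj, smul_zero]) j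

theorem repD_repVec (j : ℕ) : repD n (repVec k n j) = repVec k n (j + 1) :=
  repOp_repVec (fun j hj => repVec_of_le (by omega)) j

variable {n q} [hn : Fact (2 ≤ n)] [hq : Fact (IsPrimitiveRoot q n)]

theorem repA_succ (j : ℕ) :
    repA n q τ (repVec k n (j + 1)) = repCoeff q τ j • repVec k n j := by
  unfold repA
  rw [repOp_repVec (fun j hj => if_pos (Or.inr hj))]
  rcases lt_trichotomy (j + 1) n with h | h | h
  · rw [if_neg (by omega), Nat.add_sub_cancel]
  · -- The coefficient vanishes for `j + 1 = n`, since `(n)_q = 0`.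
    rw [if_pos (by omega), repCoeff, h, qint_order hq.out hn.out, zero_mul, zero_smul]
  · rw [if_pos (by omega), repVec_of_le (by omega), smul_zero]

theorem repA_pow_add (m j : ℕ) : (repA n q τ ^ m) (repVec k n (j + m)) =
    (∏ i ∈ Finset.range m, repCoeff q τ (j + i)) • repVec k n j := by
  induction m with
  | zero => simp
  | succ m ih =>
    rw [pow_succ, Module.End.mul_apply, ← add_assoc, repA_succ, map_smul, ih, smul_smul,
      Finset.prod_range_succ, mul_comm]

theorem repA_pow_of_lt {m j : ℕ} (h : j < m) : (repA n q τ ^ m) (repVec k n j) = 0 := by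
  obtain ⟨t, rfl⟩ := Nat.exists_eq_add_of_lt h
  have h1 := repA_pow_add (n := n) (q := q) τ j 0
  rw [zero_add] at h1
  rw [show j + t + 1 = t + 1 + j by omega, pow_add, Module.End.mul_apply, h1, map_smul, pow_succ,
    Module.End.mul_apply, repA_zero, map_zero, smul_zero]

omit hn hq in
theorem repD_pow (m j : ℕ) : (repD n ^ m) (repVec k n j) = repVec k n (j + m) := by
  induction m generalizing j with
  | zero => rfl
  | succ m ih => rw [pow_succ, Module.End.mul_apply, repD_repVec, ih, add_right_comm, add_assoc]

omit hn hq in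
theorem repB_pow (m j : ℕ) : (repB n q ^ m) (repVec k n j) = (q ^ j) ^ m • repVec k n j := by
  induction m with
  | zero => simp
  | succ m ih =>
    rw [pow_succ, Module.End.mul_apply, repB_repVec, map_smul, ih, smul_smul, pow_succ']

omit hn hq in
theorem repC_pow (m j : ℕ) : (repC n q τ ^ m) (repVec k n j) = (q ^ j * τ) ^ m • repVec k n j := by
  induction m with
  | zero => simp
  | succ m ih =>
    rw [pow_succ, Module.End.mul_apply, repC_repVec, map_smul, ih, smul_smul, pow_succ']

variable (n q) in
/-- The right module `k ^ n` of the quantum double with basis `u_0, …, u_(n - 1)`, where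
`u_j d = u_(j + 1)`, `u_j b = q ^ j u_j`, `u_j c = q ^ j τ u_j` and
`u_(j + 1) a = (j + 1)_q (1 - q ^ j τ) u_j`. -/
noncomputable def rep (hτ : τ ^ n = 1) : QuantumDouble k n q →ₐ[k] (Module.End k (Fin n → k))ᵐᵒᵖ :=
  RingQuot.liftAlgHom k ⟨FreeAlgebra.lift k (fun g => DoubleGen.casesOn g (op (repA n q τ))
    (op (repB n q)) (op (repC n q τ)) (op (repD n))), by
    have hn0 : n ≠ 0 := by have := hn.out; omega
    have hqj : ∀ j, (q ^ j) ^ n = 1 := fun j => by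
      rw [← pow_mul, mul_comm, pow_mul, hq.out.pow_eq_one, one_pow]
    intro s t h
    cases h <;> simp only [map_pow, map_mul, map_smul, map_sub, map_one, map_zero,
      FreeAlgebra.lift_ι_apply] <;> apply unop_injective <;> refine repVec_hom_ext fun j hj => ?_
    · exact repA_pow_of_lt τ hj
    · exact (repD_pow n j).trans (repVec_of_le (by omega))
    · refine (repB_pow n j).trans ?_
      rw [hqj, one_smul]
      rfl
    · refine (repC_pow τ n j).trans ?_
      rw [mul_pow, hqj, hτ, one_mul, one_smul]
      rfl
    · change repA n q τ (repB n q _) = q • repB n q (repA n q τ _)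
      cases j with
      | zero => rw [repB_repVec, map_smul, repA_zero, map_zero, smul_zero, smul_zero]
      | succ j =>
        rw [repB_repVec, map_smul, repA_succ, map_smul, repB_repVec, smul_smul, smul_smul,
          smul_smul]
        congr 1
        ring
    · change repC n q τ (repD n _) = q • repD n (repC n q τ _)
      rw [repD_repVec, repC_repVec, repC_repVec, map_smul, repD_repVec, smul_smul]
      congr 1
      ring
    · change repB n q (repD n _) = q • repD n (repB n q _)
      rw [repD_repVec, repB_repVec, repB_repVec, map_smul, repD_repVec, smul_smul]
      congr 1
      ring
    · change repC n q τ (repB n q _) = repB n q (repC n q τ _)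
      rw [repB_repVec, map_smul, repC_repVec, map_smul, repB_repVec, smul_comm]
    · change repA n q τ (repC n q τ _) = q • repC n q τ (repA n q τ _)
      cases j with
      | zero => rw [repC_repVec, map_smul, repA_zero, map_zero, smul_zero, smul_zero]
      | succ j =>
        rw [repC_repVec, map_smul, repA_succ, map_smul, repC_repVec, smul_smul, smul_smul,
          smul_smul]
        congr 1
        ring
    · change repA n q τ (repD n _) - q • repD n (repA n q τ _) =
        repVec k n j - repC n q τ (repB n q _)
      rw [repB_repVec, map_smul, repC_repVec, smul_smul, repD_repVec, repA_succ]
      cases j with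
      | zero =>
        rw [repA_zero, map_zero, smul_zero, sub_zero]
        simp [repCoeff, qint, sub_smul]
      | succ j =>
        rw [repA_succ, map_smul, repD_repVec, smul_smul, ← sub_smul]
        have h1 : repVec k n (j + 1) = (1 : k) • repVec k n (j + 1) := (one_smul _ _).symm
        conv_rhs => rw [h1, smul_smul, ← sub_smul]
        congr 1
        have h2 := qint_succ' q (j + 1)
        have h3 := qint_succ q (j + 1)
        unfold repCoeff
        linear_combination h2 - q ^ (j + 1) * τ * h3⟩

variable (hτ : τ ^ n = 1)

theorem rep_gen (g : DoubleGen) : rep n q τ hτ (gen k n q g) =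
    DoubleGen.casesOn g (op (repA n q τ)) (op (repB n q)) (op (repC n q τ)) (op (repD n)) := by
  unfold rep gen
  erw [RingQuot.liftAlgHom_mkAlgHom_apply]
  simp

/-- The orbit map `x ↦ u_0 x`. -/
noncomputable def repEval (x : QuantumDouble k n q) : Fin n → k :=
  unop (rep n q τ hτ x) (repVec k n 0)

theorem repEval_mul (x y : QuantumDouble k n q) :
    repEval τ hτ (x * y) = unop (rep n q τ hτ y) (repEval τ hτ x) := by
  rw [repEval, map_mul, unop_mul, Module.End.mul_apply]
  rfl

theorem repEval_add (x y : QuantumDouble k n q) :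
    repEval τ hτ (x + y) = repEval τ hτ x + repEval τ hτ y := by
  rw [repEval, map_add]
  rfl

theorem repEval_sub (x y : QuantumDouble k n q) :
    repEval τ hτ (x - y) = repEval τ hτ x - repEval τ hτ y := by
  rw [repEval, map_sub]
  rfl

theorem repEval_smul (c : k) (x : QuantumDouble k n q) :
    repEval τ hτ (c • x) = c • repEval τ hτ x := by
  rw [repEval, map_smul]
  rfl

theorem repEval_one : repEval τ hτ (1 : QuantumDouble k n q) = repVec k n 0 := by
  rw [repEval, map_one]
  rfl

theorem repEval_ofTaft (r : Taft k n q) :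
    repEval τ hτ (ofTaft k n q r) = Coalgebra.counit (R := k) r • repVec k n 0 := by
  induction r using Taft.induction with
  | hk c => rw [AlgHom.commutes, Algebra.algebraMap_eq_smul_one, repEval_smul, repEval_one,
      Bialgebra.counit_algebraMap]
  | ha =>
    rw [ofTaft_a, counit_a, zero_smul, repEval, rep_gen]
    exact repA_zero n q τ
  | hb =>
    rw [ofTaft_b, counit_b, repEval, rep_gen]
    refine (repB_repVec n q 0).trans ?_
    rw [pow_zero]
  | hadd x y hx hy => rw [map_add, repEval_add, hx, hy, map_add, add_smul]
  | hmul x y hx hy =>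
    rw [map_mul, repEval_mul, hx, map_smul, Bialgebra.counit_mul, mul_smul]
    exact congrArg _ hy

/-- The orbit map factors through `Q`. -/
theorem repEval_eq_of_mk_eq {x y : QuantumDouble k n q} (h : mk k n q x = mk k n q y) :
    repEval τ hτ x = repEval τ hτ y := by
  rw [← sub_eq_zero, ← map_sub, mk_eq_zero_iff] at h
  rw [← sub_eq_zero, ← repEval_sub]
  generalize x - y = z at h ⊢
  induction h using Submodule.span_induction with
  | mem z hz =>
    obtain ⟨r, hr, rfl⟩ := hz
    rw [repEval_ofTaft, show Coalgebra.counit (R := k) r = 0 from hr, zero_smul]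
  | zero => rw [repEval, map_zero]; rfl
  | add z z' _ _ hz hz' => rw [repEval_add, hz, hz', add_zero]
  | smul s z _ hz =>
    change repEval τ hτ (z * unop s) = 0
    rw [repEval_mul, hz, map_zero]

theorem repEval_mul_a_pow (x : QuantumDouble k n q) (m : ℕ) :
    repEval τ hτ (x * gen k n q .a ^ m) = (repA n q τ ^ m) (repEval τ hτ x) := by
  rw [repEval_mul, map_pow, rep_gen]
  rfl

/-- The element of `D` whose class in `Q` corresponds to the vector `u_j`. -/
noncomputable def repLift (j : ℕ) : QuantumDouble k n q :=
  Taft.specProj n (gen k n q .c) τ * gen k n q .d ^ j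

include hτ

theorem repEval_repLift (j : ℕ) : repEval τ hτ (repLift (q := q) τ j) = repVec k n j := by
  have hn0 : n ≠ 0 := by have := hn.out; omega
  have hτ0 : τ ≠ 0 := by
    rintro rfl
    rw [zero_pow hn0] at hτ
    exact zero_ne_one hτ
  have h1 : repEval τ hτ (Taft.specProj n (gen k n q .c) τ) = repVec k n 0 := by
    unfold repEval Taft.specProj
    rw [map_smul, map_sum]
    simp only [map_smul, map_pow, rep_gen]
    change ((n : k)⁻¹ • (unop (∑ i ∈ Finset.range n, (τ ^ i)⁻¹ • op (repC n q τ) ^ i) :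
      Module.End k (Fin n → k))) _ = _
    rw [Finset.unop_sum, LinearMap.smul_apply, LinearMap.sum_apply]
    have h2 : ∀ i, (unop ((τ ^ i)⁻¹ • op (repC n q τ) ^ i) : Module.End k (Fin n → k))
        (repVec k n 0) = repVec k n 0 := by
      intro i
      rw [unop_smul, unop_pow, unop_op, LinearMap.smul_apply, repC_pow, pow_zero, one_mul,
        smul_smul, inv_mul_cancel₀ (pow_ne_zero _ hτ0), one_smul]
    simp only [h2, Finset.sum_const, Finset.card_range]
    rw [← Nat.cast_smul_eq_nsmul k, smul_smul, inv_mul_cancel₀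
      (Taft.cast_ne_zero_of_isPrimitiveRoot hq.out hn0), one_smul]
  rw [repLift, repEval_mul, h1, map_pow, rep_gen]
  exact (repD_pow j 0).trans (by rw [zero_add])

omit hn hq hτ in
theorem specProj_c_mul_b : Taft.specProj n (gen k n q .c) τ * gen k n q .b =
    gen k n q .b * Taft.specProj n (gen k n q .c) τ := by
  unfold Taft.specProj
  rw [smul_mul_assoc, mul_smul_comm, Finset.sum_mul, Finset.mul_sum]
  congr 1
  refine Finset.sum_congr rfl fun i _ => ?_
  rw [smul_mul_assoc, mul_smul_comm]
  exact congrArg _ (Commute.pow_left (b_mul_c k n q).symm i : Commute _ _)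

omit hn hq hτ in
theorem exists_specProj_c_mul_a : ∃ f, Taft.specProj n (gen k n q .c) τ * gen k n q .a =
    gen k n q .a * f := by
  refine ⟨(n : k)⁻¹ • ∑ i ∈ Finset.range n, ((τ ^ i)⁻¹ * q ^ i) • gen k n q .c ^ i, ?_⟩
  unfold Taft.specProj
  rw [smul_mul_assoc, mul_smul_comm, Finset.sum_mul, Finset.mul_sum]
  congr 1
  refine Finset.sum_congr rfl fun i _ => ?_
  rw [smul_mul_assoc, mul_smul_comm, c_pow_mul_a, smul_smul]

omit hτ in
theorem actB_repLift (j : ℕ) : Taft.actB k n q _ (mk k n q (repLift τ j))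
    = q ^ j • mk k n q (repLift τ j) := by
  rw [actB_mk, repLift, mk_mul_d_pow_mul_b (specProj_c_mul_b τ)]

theorem actA_repLift_succ (j : ℕ) : Taft.actA k n q _ (mk k n q (repLift τ (j + 1)))
    = repCoeff q τ j • mk k n q (repLift τ j) := by
  have hn0 : n ≠ 0 := by have := hn.out; omega
  obtain ⟨f, hf⟩ := exists_specProj_c_mul_a (n := n) (q := q) τ
  rw [actA_mk, repLift, mk_mul_d_pow_mul_a (specProj_c_mul_b τ) hf,
    Taft.specProj_mul hn0 (c_pow k n q) hτ, smul_mul_assoc, map_smul, repCoeff, mul_smul, sub_smul,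
    one_smul, mul_smul]
  rfl

omit hτ in
theorem actA_repLift_zero : Taft.actA k n q _ (mk k n q (repLift τ 0)) = 0 := by
  obtain ⟨f, hf⟩ := exists_specProj_c_mul_a (n := n) (q := q) τ
  rw [actA_mk, repLift, pow_zero, mul_one, hf, mk_a_mul]

theorem actA_pow_repLift (m j : ℕ) : (Taft.actA k n q _ ^ m) (mk k n q (repLift τ (j + m))) =
    (∏ i ∈ Finset.range m, repCoeff q τ (j + i)) • mk k n q (repLift τ j) := by
  induction m with
  | zero => simp
  | succ m ih =>
    rw [pow_succ, Module.End.mul_apply, ← add_assoc, actA_repLift_succ τ hτ, map_smul, ih,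
      smul_smul, Finset.prod_range_succ, mul_comm]

/-- A coordinate of the orbit map detects that `u_(t + r) a ^ r` is not in `Q a ^ (r + 1)`. -/
theorem hasString_Q_of_coord {r t : ℕ} (ht : t < n)
    (h0 : (Taft.actA k n q _ ^ (r + 1)) (mk k n q (repLift τ (t + r))) = 0)
    (h1 : ∏ i ∈ Finset.range r, repCoeff q τ (t + i) ≠ 0)
    (h2 : ∀ x, (repA n q τ ^ (r + 1)) x ⟨t, ht⟩ = 0) :
    Taft.HasString k n q (Q k n q) r (q ^ (t + r)) := by
  refine ⟨_, actB_repLift τ _, h0, fun v hv => ?_⟩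
  obtain ⟨x, rfl⟩ := mk_surjective v
  rw [actA_pow_mk, actA_pow_mk] at hv
  have h3 := congrFun (repEval_eq_of_mk_eq τ hτ hv) ⟨t, ht⟩
  rw [repEval_mul_a_pow, h2, repEval_mul_a_pow, repEval_repLift, repA_pow_add, Pi.smul_apply,
    repVec_apply, if_pos rfl, smul_eq_mul, mul_one] at h3
  exact h1 h3.symm

end Representation

section Strings

variable {k : Type u} [Field k] {n : ℕ} {q : k}
  [hn : Fact (2 ≤ n)] [hq : Fact (IsPrimitiveRoot q n)]

omit hn in
theorem repCoeff_ne_zero {τ : k} {j : ℕ} (hj : j + 1 < n) (h : q ^ j * τ ≠ 1) :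
    repCoeff q τ j ≠ 0 :=
  mul_ne_zero (qint_ne_zero hq.out (Nat.succ_ne_zero j) hj) (sub_ne_zero.2 (Ne.symm h))

/-- The string at the bottom of the chain `u_0, …, u_(n - 1)` for `τ = q ^ (-r)`. -/
theorem hasString_Q_bot {r : ℕ} (hr : r < n) : Taft.HasString k n q (Q k n q) r (q ^ r) := by
  have hn0 : n ≠ 0 := by have := hn.out; omega
  have hq0 := hq.out.ne_zero hn0
  let τ : k := (q ^ r)⁻¹
  have hτ : τ ^ n = 1 := by
    rw [inv_pow, ← pow_mul, mul_comm, pow_mul, hq.out.pow_eq_one, one_pow, inv_one]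
  have h := hasString_Q_of_coord (q := q) τ hτ (r := r) (t := 0) (by omega) ?_ ?_ ?_
  · rwa [zero_add] at h
  · rw [pow_succ', Module.End.mul_apply, actA_pow_repLift τ hτ, map_smul, actA_repLift_zero,
      smul_zero]
  · rw [Finset.prod_ne_zero_iff]
    intro i hi
    have hi := Finset.mem_range.1 hi
    rw [zero_add]
    refine repCoeff_ne_zero (n := n) (j := i) (by omega) fun h => ?_
    rw [mul_inv_eq_one₀ (pow_ne_zero _ hq0)] at h
    have := hq.out.pow_inj (by omega) hr h
    omega
  · intro x
    have h3 : (LinearMap.proj ⟨0, by omega⟩ : (Fin n → k) →ₗ[k] k) ∘ₗ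
        (repA n q τ ^ (r + 1)) = 0 := by
      refine repVec_hom_ext fun j _ => ?_
      rw [LinearMap.comp_apply, LinearMap.zero_apply]
      rcases lt_or_ge j (r + 1) with hj | hj
      · rw [repA_pow_of_lt τ hj, map_zero]
      · obtain ⟨t, rfl⟩ := Nat.exists_eq_add_of_le' hj
        rw [repA_pow_add, map_smul, LinearMap.proj_apply, repVec_apply]
        rcases Nat.eq_zero_or_pos t with rfl | ht
        · rw [Finset.prod_range_succ, zero_add, repCoeff, mul_inv_cancel₀ (pow_ne_zero _ hq0),
            sub_self, mul_zero, mul_zero, zero_smul]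
        · rw [if_neg (by simp; omega), smul_zero]
    exact LinearMap.congr_fun h3 x

/-- The string at the top of the chain `u_0, …, u_(n - 1)` for `τ = q ^ (r + 2)`, in which
`u_(n - 1 - r) a = 0`. -/
theorem hasString_Q_top {r : ℕ} (hr : r < n) : Taft.HasString k n q (Q k n q) r (q ^ (n - 1)) := by
  have hn0 : n ≠ 0 := by have := hn.out; omega
  have hq0 := hq.out.ne_zero hn0
  let τ : k := q ^ (r + 2)
  have hτ : τ ^ n = 1 := by
    rw [← pow_mul, mul_comm, pow_mul, hq.out.pow_eq_one, one_pow]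
  have h := hasString_Q_of_coord (q := q) τ hτ (r := r) (t := n - 1 - r) (by omega) ?_ ?_ ?_
  · rwa [Nat.sub_add_cancel (by omega)] at h
  · rw [pow_succ', Module.End.mul_apply, actA_pow_repLift τ hτ, map_smul]
    rcases Nat.eq_zero_or_pos (n - 1 - r) with h | h
    · rw [h, actA_repLift_zero, smul_zero]
    · rw [← Nat.sub_add_cancel h, actA_repLift_succ τ hτ, repCoeff, ← pow_add,
        show n - 1 - r - Nat.succ 0 + (r + 2) = n by omega, hq.out.pow_eq_one, sub_self, mul_zero,
        zero_smul, smul_zero]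
  · rw [Finset.prod_ne_zero_iff]
    intro i hi
    have hi := Finset.mem_range.1 hi
    refine repCoeff_ne_zero (n := n) (j := n - 1 - r + i) (by omega) fun h => ?_
    rw [← pow_add, show n - 1 - r + i + (r + 2) = n + (i + 1) by omega, pow_add,
      hq.out.pow_eq_one, one_mul] at h
    exact hq.out.pow_ne_one_of_pos_of_lt (by omega) (by omega) h
  · intro x
    have h3 : (LinearMap.proj ⟨n - 1 - r, by omega⟩ : (Fin n → k) →ₗ[k] k) ∘ₗ
        (repA n q τ ^ (r + 1)) = 0 := by
      refine repVec_hom_ext fun j hjn => ?_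
      rw [LinearMap.comp_apply, LinearMap.zero_apply]
      rcases lt_or_ge j (r + 1) with hj | hj
      · rw [repA_pow_of_lt τ hj, map_zero]
      · obtain ⟨t, rfl⟩ := Nat.exists_eq_add_of_le' hj
        rw [repA_pow_add, map_smul, LinearMap.proj_apply, repVec_apply, if_neg (by simp; omega),
          smul_zero]
    exact LinearMap.congr_fun h3 x

/-- The generator `a` of `U_n(q)` has nilpotency order exactly `n`. -/
theorem _root_.Taft.a_pow_ne_zero : Taft.a k n q ^ (n - 1) ≠ 0 := by
  intro h
  have hn2 := hn.out
  obtain ⟨w, -, -, hw⟩ := hasString_Q_bot (k := k) (n := n) (q := q) (r := n - 1) (by omega)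
  apply hw 0
  rw [map_zero, Taft.actA, ← map_pow, ← op_pow, h, op_zero, map_zero, LinearMap.zero_apply]

end Strings

end QuantumDouble

/-! ### Krull–Schmidt decompositions -/

/-- In a module of finite length every submodule is a finite direct sum of indecomposables. -/
theorem exists_indecomposable_decomposition {A W : Type*} [Ring A] [AddCommGroup W] [Module A W]
    [IsArtinian A W] (S : Submodule A W) :
    ∃ (s : Finset (Submodule A W)), s.SupIndep id ∧ s.sup id = S ∧
      ∀ T ∈ s, IsIndecomposableModule A T := by
  classical
  induction S using IsArtinian.induction with
  | _ S ih =>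
  by_cases hS : S = ⊥
  · exact ⟨∅, Finset.supIndep_empty _, by rw [hS, Finset.sup_empty], by simp⟩
  by_cases hind : IsIndecomposableModule A S
  · exact ⟨{S}, Finset.supIndep_singleton _ _, by simp, by simpa using hind⟩
  have hnt : Nontrivial S := Submodule.nontrivial_iff_ne_bot.2 hS
  rw [IsIndecomposableModule, not_and] at hind
  have h1 := hind hnt
  push Not at h1
  obtain ⟨P, R, hPR, hP, hR⟩ := h1
  have hinj : Function.Injective S.subtype := S.subtype_injective
  have hdisj : Disjoint (P.map S.subtype) (R.map S.subtype) :=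
    Submodule.disjoint_map hinj hPR.disjoint
  have hsup : P.map S.subtype ⊔ R.map S.subtype = S := by
    rw [← Submodule.map_sup, hPR.sup_eq_top, Submodule.map_top, Submodule.range_subtype]
  have hP' : P.map S.subtype ≠ ⊥ := fun h =>
    hP (Submodule.map_injective_of_injective hinj (h.trans (Submodule.map_bot _).symm))
  have hR' : R.map S.subtype ≠ ⊥ := fun h =>
    hR (Submodule.map_injective_of_injective hinj (h.trans (Submodule.map_bot _).symm))
  have hPle : P.map S.subtype ≤ S := le_sup_left.trans_eq hsup
  have hRle : R.map S.subtype ≤ S := le_sup_right.trans_eq hsup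
  have hPlt : P.map S.subtype < S := by
    refine lt_of_le_of_ne hPle fun h => hR' ?_
    rw [h] at hdisj
    exact hdisj.eq_bot_of_ge hRle
  have hRlt : R.map S.subtype < S := by
    refine lt_of_le_of_ne hRle fun h => hP' ?_
    rw [h] at hdisj
    exact hdisj.eq_bot_of_le hPle
  obtain ⟨s, hs1, hs2, hs3⟩ := ih _ hPlt
  obtain ⟨t, ht1, ht2, ht3⟩ := ih _ hRlt
  refine ⟨s ∪ t, ?_, by rw [Finset.sup_union, hs2, ht2, hsup], fun T hT => ?_⟩
  · refine Finset.SupIndep.union hs1 ht1 ?_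
    rwa [hs2, ht2]
  · exact (Finset.mem_union.1 hT).elim (hs3 T) (ht3 T)

theorem exists_isKrullSchmidtDecomposition {A W : Type*} [Ring A] [AddCommGroup W] [Module A W]
    [IsArtinian A W] :
    ∃ (m : ℕ) (V : Fin m → Submodule A W), IsKrullSchmidtDecomposition A V := by
  obtain ⟨s, h1, h2, h3⟩ := exists_indecomposable_decomposition (A := A) (⊤ : Submodule A W)
  refine ⟨s.card, fun i => (s.equivFin.symm i : Submodule A W), ?_, ?_,
    fun i => h3 _ (Subtype.coe_prop _)⟩
  · exact h1.independent.comp s.equivFin.symm.injective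
  · rw [s.equivFin.symm.iSup_comp (g := fun T : s => (T : Submodule A W)), ← h2,
      Finset.sup_eq_iSup, iSup_subtype]
    rfl

namespace Taft

open QuantumDouble

variable {k : Type u} [Field k] {n : ℕ} {q : k}
  [hn : Fact (2 ≤ n)] [hq : Fact (IsPrimitiveRoot q n)]

/-! ### The modules `M(x, y)` -/

omit hn hq in
theorem idem_eq_specProj (i : ℤ) : idem k n q i = specProj n (b k n q) (q ^ (1 - i)) := by
  unfold idem specProj
  congr 1
  refine Finset.sum_congr rfl fun j _ => ?_
  rw [← zpow_natCast, ← zpow_mul, ← zpow_neg]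
  congr 2
  ring

omit hn hq in
theorem a_pow_mul_b (m : ℕ) : b k n q * a k n q ^ m = q ^ m • (a k n q ^ m * b k n q) := by
  induction m with
  | zero => simp
  | succ m ih =>
    rw [pow_succ, ← mul_assoc, ih, smul_mul_assoc, mul_assoc, b_mul_a, mul_smul_comm, smul_smul,
      mul_assoc, pow_succ]

theorem idem_mul_a_pow_ne_zero (i : ℤ) : idem k n q i * a k n q ^ (n - 1) ≠ 0 := by
  have hn0 : n ≠ 0 := by have := hn.out; omega
  have hq0 := hq.out.ne_zero hn0
  intro h
  -- The automorphism `a ↦ a`, `b ↦ q ^ m b` permutes the idempotents, and they add up to `1`.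
  have hσ : ∀ y : ℕ, specProj n (b k n q) (q ^ y) * a k n q ^ (n - 1) = 0 := by
    intro y
    have hz : (q ^ (1 - i - y)) ^ n = 1 := by
      rw [← zpow_natCast, ← zpow_mul, mul_comm, zpow_mul, zpow_natCast, hq.out.pow_eq_one, one_zpow]
    let σ : Taft k n q →ₐ[k] Taft k n q := lift (a k n q) (q ^ (1 - i - y) • b k n q) (a_pow k n q)
      (by rw [smul_pow, b_pow, hz, one_smul])
      (by rw [smul_mul_assoc, b_mul_a, mul_smul_comm, smul_comm])
    have h1 := congrArg σ h
    rw [idem_eq_specProj, map_mul, map_pow, map_zero] at h1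
    simp only [σ, specProj, map_smul, map_sum, map_pow, lift_a, lift_b] at h1
    rw [← h1]
    congr 1
    unfold specProj
    congr 1
    refine Finset.sum_congr rfl fun j _ => ?_
    rw [smul_pow, smul_smul]
    congr 1
    rw [← inv_pow, ← inv_pow _ j, ← mul_pow, ← zpow_natCast q y, ← zpow_neg, ← zpow_neg,
      ← zpow_add₀ hq0]
    congr 2
    ring
  apply a_pow_ne_zero (k := k) (n := n) (q := q)
  rw [← one_mul (a k n q ^ (n - 1)), ← sum_specProj hq.out hn0 (b k n q), Finset.sum_mul]
  exact Finset.sum_eq_zero fun y _ => hσ y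

/-- `M(l, y)` is the string module generated by `e_(l - y + 1) a ^ (n - l)`. -/
theorem isString_Indec {l y : ℕ} (hl : 1 ≤ l) (hln : l ≤ n) :
    IsString k n q (Indec k n q l y) (l - 1) (q ^ y) := by
  have hn0 : n ≠ 0 := by have := hn.out; omega
  have hq0 := hq.out.ne_zero hn0
  have hA : ∀ (m : ℕ) (z : Indec k n q l y), (((actA k n q (Indec k n q l y) ^ m) z :
      Indec k n q l y) : Taft k n q) = z * a k n q ^ m := by
    intro m
    induction m with
    | zero => simp
    | succ m ih =>
      intro z
      rw [pow_succ, Module.End.mul_apply, ih, pow_succ', ← mul_assoc]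
      rfl
  let g : Indec k n q l y :=
    ⟨idem k n q ((l : ℤ) - y + 1) * a k n q ^ (n - l), Submodule.mem_span_singleton_self _⟩
  refine ⟨g, Subtype.ext ?_, Subtype.ext ?_, fun h => ?_, ?_⟩
  · change idem k n q ((l : ℤ) - y + 1) * a k n q ^ (n - l) * b k n q =
      q ^ y • (idem k n q ((l : ℤ) - y + 1) * a k n q ^ (n - l))
    have hz : ∀ z : ℤ, (q ^ z) ^ n = 1 := fun z => by
      rw [← zpow_natCast, ← zpow_mul, mul_comm, zpow_mul, zpow_natCast, hq.out.pow_eq_one, one_zpow]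
    have h1 : a k n q ^ (n - l) * b k n q = (q ^ (n - l))⁻¹ • (b k n q * a k n q ^ (n - l)) := by
      rw [a_pow_mul_b, smul_smul, inv_mul_cancel₀ (pow_ne_zero _ hq0), one_smul]
    rw [mul_assoc, h1, mul_smul_comm, ← mul_assoc, idem_eq_specProj,
      specProj_mul hn0 (b_pow k n q) (hz _), smul_mul_assoc, smul_smul]
    congr 1
    rw [← zpow_natCast, ← zpow_neg, ← zpow_add₀ hq0, Nat.cast_sub hln,
      show -((n : ℤ) - l) + (1 - (l - y + 1)) = y - n by ring, zpow_sub₀ hq0, zpow_natCast,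
      zpow_natCast, hq.out.pow_eq_one, div_one]
  · rw [hA]
    change idem k n q _ * a k n q ^ (n - l) * a k n q ^ (l - 1 + 1) = 0
    rw [mul_assoc, ← pow_add, show n - l + (l - 1 + 1) = n by omega, a_pow, mul_zero]
  · have h1 := hA (l - 1) g
    rw [h] at h1
    change 0 = idem k n q _ * a k n q ^ (n - l) * a k n q ^ (l - 1) at h1
    rw [mul_assoc, ← pow_add, show n - l + (l - 1) = n - 1 by omega] at h1
    exact idem_mul_a_pow_ne_zero _ h1.symm
  · rw [eq_top_iff]
    rintro ⟨v, hv⟩ -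
    obtain ⟨x, rfl⟩ := Submodule.mem_span_singleton.1 hv
    exact Submodule.mem_span_singleton.2 ⟨x, rfl⟩

/-! ### Strings in `Q ⊗ Q` -/

/-- For `y = -1, 0, …, r - 1` the string is the longest one in a product of strings with top
eigenvalues `q ^ (-1)` and `q ^ (y + 1)`, for `y = r, …, n - 2` it is the shortest one in a product
of strings with top eigenvalues `q ^ y` and `q ^ (y - r)`. -/
theorem hasString_QQ {r y : ℕ} (hr : r < n) (hy : y < n) :
    HasString k n q (QQ k n q) r (q ^ y) := by
  have hn0 : n ≠ 0 := by have := hn.out; omega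
  have hq0 := hq.out.ne_zero hn0
  have htop : ∀ x z : ℕ, x + z = r → HasString k n q (QQ k n q) r (q ^ (n - 1) * q ^ z) := by
    rintro x z rfl
    exact (hasString_Q_top (by omega)).rightTensor_top hr (hasString_Q_bot (by omega))
  rcases Nat.lt_or_ge y r with h | h
  · have h1 := htop (r - (y + 1)) (y + 1) (by omega)
    rwa [← pow_add, show n - 1 + (y + 1) = n + y by omega, pow_add, hq.out.pow_eq_one,
      one_mul] at h1
  · rcases Nat.lt_or_ge (y + 1) n with h' | h'
    · obtain ⟨s, rfl⟩ := Nat.exists_eq_add_of_le h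
      have h1 := HasString.rightTensor_bot (r := r) (s := s) (by omega)
        (hasString_Q_bot (k := k) (n := n) (q := q) (r := r + s) (by omega))
        (hasString_Q_bot (k := k) (n := n) (q := q) (r := s) (by omega))
      rwa [mul_div_cancel_right₀ _ (pow_ne_zero _ hq0)] at h1
    · have h1 := htop r 0 rfl
      rwa [pow_zero, mul_one, show n - 1 = y by omega] at h1

theorem isArtinian_QQ : IsArtinian (Taft k n q)ᵐᵒᵖ (QQ k n q) := by
  have : Module.Finite k (Q k n q) := finite_Q
  have : Module.Finite k (QQ k n q) :=
    inferInstanceAs (Module.Finite k (Q k n q ⊗[k] Q k n q))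
  exact isArtinian_of_tower k inferInstance

/-- Every indecomposable module is one of the `M(x, y)`. -/
theorem exists_equiv_Indec {M : Type*} [AddCommGroup M] [Module (Taft k n q)ᵐᵒᵖ M]
    (hM : IsIndecomposableModule (Taft k n q)ᵐᵒᵖ M) :
    ∃ x y : ℕ, 1 ≤ x ∧ x ≤ n ∧ y < n ∧ Nonempty (M ≃ₗ[(Taft k n q)ᵐᵒᵖ] Indec k n q x y) := by
  have hn0 : n ≠ 0 := by have := hn.out; omega
  let : Module k M := Module.compHom M (algebraMap k (Taft k n q)ᵐᵒᵖ)
  have : IsScalarTower k (Taft k n q)ᵐᵒᵖ M := ⟨fun c x v => by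
    rw [Algebra.smul_def, mul_smul]
    rfl⟩
  have := hM.1
  obtain ⟨r, y, hr, hy, h⟩ := exists_hasString (k := k) (n := n) (q := q) (M := M) hq.out hn0
  refine ⟨r + 1, y, by omega, by omega, hy, ?_⟩
  exact (h.isString hq.out hn0 hM).nonempty_linearEquiv (hq.out.ne_zero hn0) hr
    (isString_Indec (l := r + 1) (by omega) (by omega))

end Taft

open Taft QuantumDouble in
/-- The modules `M(x, y)` with `1 ≤ x ≤ n` and `0 ≤ y ≤ n - 1` represent the isomorphism classes of
indecomposable right `U_n(q)`-modules, and each of these occurs in `Q ⊗ Q`. -/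
theorem theorem5p2 (k : Type u) [Field k] (n : ℕ) (q : k) [Fact (2 ≤ n)]
    [Fact (IsPrimitiveRoot q n)] :
    -- the `M(x, y)` are indecomposable and pairwise non-isomorphic
    (∀ x y : ℕ, 1 ≤ x → x ≤ n → y < n → IsIndecomposableModule (Taft k n q)ᵐᵒᵖ (Indec k n q x y)) ∧
    (∀ x y x' y' : ℕ, 1 ≤ x → x ≤ n → y < n → 1 ≤ x' → x' ≤ n → y' < n →
      Nonempty (Indec k n q x y ≃ₗ[(Taft k n q)ᵐᵒᵖ] Indec k n q x' y') → x = x' ∧ y = y') ∧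
    -- every indecomposable is one of them
    (∀ (M : Type w) [AddCommGroup M] [Module (Taft k n q)ᵐᵒᵖ M],
      IsIndecomposableModule (Taft k n q)ᵐᵒᵖ M →
      ∃ x y : ℕ, 1 ≤ x ∧ x ≤ n ∧ y < n ∧
        Nonempty (M ≃ₗ[(Taft k n q)ᵐᵒᵖ] Indec k n q x y)) ∧
    -- every indecomposable is a direct summand of `Q ⊗ Q`
    (∀ (M : Type w) [AddCommGroup M] [Module (Taft k n q)ᵐᵒᵖ M],
      IsIndecomposableModule (Taft k n q)ᵐᵒᵖ M →
      IsSummandOf (Taft k n q)ᵐᵒᵖ M (QQ k n q)) ∧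
    -- `Q ⊗ Q` has a Krull–Schmidt decomposition, and every indecomposable occurs in each of them
    (∃ (m : ℕ) (V : Fin m → Submodule (Taft k n q)ᵐᵒᵖ (QQ k n q)),
      IsKrullSchmidtDecomposition (Taft k n q)ᵐᵒᵖ V) ∧
    (∀ (m : ℕ) (V : Fin m → Submodule (Taft k n q)ᵐᵒᵖ (QQ k n q)),
      IsKrullSchmidtDecomposition (Taft k n q)ᵐᵒᵖ V →
      ∀ (M : Type w) [AddCommGroup M] [Module (Taft k n q)ᵐᵒᵖ M],
        IsIndecomposableModule (Taft k n q)ᵐᵒᵖ M →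
        ∃ i, Nonempty (M ≃ₗ[(Taft k n q)ᵐᵒᵖ] V i)) := by
  have hn : 2 ≤ n := Fact.out
  have hq : IsPrimitiveRoot q n := Fact.out
  have hn0 : n ≠ 0 := by omega
  have hq0 := hq.ne_zero hn0
  refine ⟨fun x y hx hxn _ => (isString_Indec hx hxn).isIndecomposableModule hq0 (by omega), ?_,
    fun M _ _ hM => exists_equiv_Indec hM, fun M _ _ hM => ?_, ?_, fun m V hV M _ _ hM => ?_⟩
  · rintro x y x' y' hx hxn hy hx' hxn' hy' ⟨e⟩
    obtain ⟨h1, h2⟩ := (isString_Indec hx hxn).unique hq0 (by omega) (by omega)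
      (isString_Indec hx' hxn') e
    exact ⟨by omega, hq.pow_inj hy hy' h2⟩
  · obtain ⟨x, y, hx, hxn, hy, ⟨e⟩⟩ := exists_equiv_Indec hM
    obtain ⟨S, T, hST, hS⟩ := (hasString_QQ (k := k) (q := q) (r := x - 1) (by omega)
      hy).exists_isCompl hq hn0
    obtain ⟨e'⟩ := (isString_Indec hx hxn).nonempty_linearEquiv hq0 (by omega) hS
    exact ⟨S, T, hST, ⟨e.trans e'⟩⟩
  · have := isArtinian_QQ (k := k) (n := n) (q := q)
    exact exists_isKrullSchmidtDecomposition
  · obtain ⟨x, y, hx, hxn, hy, ⟨e⟩⟩ := exists_equiv_Indec hM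
    have hint : DirectSum.IsInternal V :=
      DirectSum.isInternal_submodule_of_iSupIndep_of_iSup_eq_top hV.independent hV.span
    obtain ⟨i, hi⟩ := (hasString_QQ (k := k) (q := q) (r := x - 1) (by omega)
      hy).exists_of_isInternal hint
    obtain ⟨e'⟩ := (isString_Indec hx hxn).nonempty_linearEquiv hq0 (by omega)
      (hi.isString hq hn0 (hV.indecomposable i))
    exact ⟨i, ⟨e.trans e'⟩⟩
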